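/- Let $F_\infty$ be the free group of countably infinite rank. For a set of words $V\subseteq F_\infty$ and a group $G$, let $V(G)$ be the verbal subgroup, i.e. the subgroup of $G$ generated by all values $v(g_1,\dots,g_n)$ with $v\in V$ and $g_1,\dots,g_n\in G$; call $V$ non-trivial if $V(F_\infty)\neq\{1\}$. A full order on a group is a linear order $<$ such that $g_1<g_2$ implies $g_1x<g_2x$ and $xg_1<xg_2$ for all $x$. For groups $A,B$ let $A\,\mathrm{Wr}\,B$ be their Cartesian wreath product, i.e. the semidirect product of the group $A^B$ of all maps $B\to A$ with $B$ acting by translation. Let $\mathfrak N_c$ be the variety of nilpotent groups of class at most $c$, and $F_k(\mathfrak N_c)$ its free group of rank $k$. Theorem. Let $V$ be a non-trivial word set. Then there is a least integer $c\ge 0$ such that $\mathfrak N_c$ is not contained in the variety of groups in which all words of $V$ are identities. For this $c$ there is a $k$ such that the group $S=F_k(\mathfrak N_c)$ has a full order for which $V(S)$ contains an element $a>1$, and such that the iterated wreath product $((\mathbb Q\,\mathrm{Wr}\,S)\,\mathrm{Wr}\,\mathbb Z)\,\mathrm{Wr}\,\mathbb Z$ has a subgroup $G$ with the following properties: $G$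 is generated by two elements; $G$ is solvable of length at most $c+3$; and $G$ has a full order for which there is an injective homomorphism $\varphi:\mathbb Q\to G$ from the additive group of rational numbers such that $p<q$ if and only if $\varphi(p)<\varphi(q)$, the image $\varphi(\mathbb Q)$ is a subnormal subgroup of $G$, and $\varphi(\mathbb Q)\subseteq V(G)$. -/

import Mathlib

/-- The verbal subgroup `V(G)`: the subgroup generated by all values in `G` of the words in `V`,
where the words are elements of the free group of countably infinite rank. -/
def verbalSubgroup (V : Set (FreeGroup ℕ)) (G : Type*) [Group G] : Subgroup G :=
  Subgroup.closure {g | ∃ v ∈ V, ∃ f : ℕ → G, FreeGroup.lift f v = g}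

/-- A word set is non-trivial if its verbal subgroup in the free group of countably infinite rank
is non-trivial. -/
def NontrivialWordSet (V : Set (FreeGroup ℕ)) : Prop :=
  verbalSubgroup V (FreeGroup ℕ) ≠ ⊥

/-- `G` belongs to the variety defined by `V`: every word of `V` is an identity of `G`. -/
def InVariety (V : Set (FreeGroup ℕ)) (G : Type*) [Group G] : Prop :=
  ∀ v ∈ V, ∀ f : ℕ → G, FreeGroup.lift f v = 1

/-- The variety of all nilpotent groups of class at most `c` is contained in the variety
defined by `V`. (Identities involve finitely many elements at a time, so that it makes no
difference in which universe the groups live.) -/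
def NilpotentVarietyLE (c : ℕ) (V : Set (FreeGroup ℕ)) : Prop :=
  ∀ (H : Type) [Group H], Group.IsNilpotent H → Group.nilpotencyClass H ≤ c → InVariety V H

/-- A linear order on a group is a full order if it is strictly compatible with multiplication
on both sides. -/
def IsFullOrder (G : Type*) [Group G] [LinearOrder G] : Prop :=
  ∀ g₁ g₂ : G, g₁ < g₂ → ∀ x : G, g₁ * x < g₂ * x ∧ x * g₁ < x * g₂

/-- The free group of rank `k` in the variety of nilpotent groups of class at most `c`. The lower
central series is indexed from `0`, so its term with index `c` is `γ_{c+1}`. -/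
abbrev FreeNilpotentGroup (k c : ℕ) : Type :=
  FreeGroup (Fin k) ⧸ Subgroup.lowerCentralSeries (⊤ : Subgroup (FreeGroup (Fin k))) c

/-- The iterated Cartesian wreath product `((ℚ Wr S) Wr C) Wr Z` with `S` free nilpotent of class
`c` and rank `k`, and with `C`, `Z` infinite cyclic. -/
abbrev TripleWreath (k c : ℕ) : Type :=
  ((Multiplicative ℚ ≀ᵣ FreeNilpotentGroup k c) ≀ᵣ Multiplicative ℤ) ≀ᵣ Multiplicative ℤ

/-! Existence of `c`: some `v ≠ 1` lies in `V`, and `exists_isNilpotent_lift_ne_one` gives it a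
nontrivial value in a nilpotent group of unitriangular integer matrices. A word involves finitely
many letters, so its failure in class `c` is already visible in some `S = F_k(𝔑_c)`, which gives a
nontrivial element of `V(S)`.

Order on `S`: a torsion-free nilpotent group is orderable, lexicographically along central
extensions. Torsion-freeness of `S` comes from eliminating generators one at a time: a free
nilpotent group with weighted generators embeds in a semidirect product of another such group with ℤ
(`WeightedNilpotent.torsionFree`). After inversion if necessary, `V(S)` contains some `a > 1`.

Construction of `G`: for rational `x`, let `f` be the function on `S` equal to `x` at `1, a, a², …`
and trivial elsewhere. Dividing `f` by its translate by `a` leaves the value `x` at the identity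
alone, so this copy of ℚ consists of commutators with `a` and hence lies in the verbal subgroup of
the group `K` generated by `S` and all these `f`. The countable group `K` is embedded in a
two-generator group by two wreath products with ℤ: the same commutator trick writes each generator
of `K`, placed at the identity, as `⁅q i, p⁆` with `p` fixed, and a single function with `p` at the
identity and the `q i` at sparse places recovers all these commutators
(`singleHom_commutator_mem_spreadSubgroup`).

Order on `G`: all functions used have well-ordered support, and on such elements the comparison at
the least point of the support is a full order (`isPositiveCone_lexCone`). The copy of ℚ is
subnormal because functions concentrated at the identity are normal in the base group, which is
normal in the wreath product. -/

open scoped commutatorElement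

/-! ### Positive cones and full orders -/

/-- `P` is the set of positive elements of a full order on the subgroup `H`. -/
structure IsPositiveCone {G : Type*} [Group G] (H : Subgroup G) (P : Set G) : Prop where
  subset : ∀ x ∈ P, x ∈ H
  one_notMem : (1 : G) ∉ P
  mul_mem : ∀ x ∈ P, ∀ y ∈ P, x * y ∈ P
  conj_mem : ∀ h ∈ H, ∀ x ∈ P, h * x * h⁻¹ ∈ P
  mem_or_inv_mem : ∀ h ∈ H, h ≠ 1 → h ∈ P ∨ h⁻¹ ∈ P

namespace IsPositiveCone

variable {G K : Type*} [Group G] [Group K]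

theorem comap {H : Subgroup G} {P : Set G} (hP : IsPositiveCone H P) (f : K →* G)
    (hf : Function.Injective f) (hH : ∀ x, f x ∈ H) :
    IsPositiveCone (⊤ : Subgroup K) (f ⁻¹' P) where
  subset _ _ := Subgroup.mem_top _
  one_notMem := by simpa using hP.one_notMem
  mul_mem x hx y hy := by simpa using hP.mul_mem _ hx _ hy
  conj_mem h _ x hx := by simpa using hP.conj_mem _ (hH h) _ hx
  mem_or_inv_mem h _ h1 := by
    simpa using hP.mem_or_inv_mem (f h) (hH h) ((map_ne_one_iff f hf).2 h1)

theorem exists_fullOrder {P : Set G} (hP : IsPositiveCone (⊤ : Subgroup G) P) :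
    ∃ _ : LinearOrder G, IsFullOrder G ∧ ∀ x y : G, x < y ↔ x⁻¹ * y ∈ P := by
  classical
  have asymm : ∀ x, x ∈ P → x⁻¹ ∉ P := fun x hx hx' =>
    hP.one_notMem (by simpa using hP.mul_mem _ hx _ hx')
  let o : LinearOrder G :=
    { le := fun x y => x = y ∨ x⁻¹ * y ∈ P
      lt := fun x y => x⁻¹ * y ∈ P
      le_refl := fun x => Or.inl rfl
      le_trans := by
        rintro x y z (rfl | hxy) (rfl | hyz)
        · exact Or.inl rfl
        · exact Or.inr hyz
        · exact Or.inr hxy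
        · exact Or.inr (by simpa [mul_assoc] using hP.mul_mem _ hxy _ hyz)
      lt_iff_le_not_ge := by
        intro x y
        constructor
        · intro h
          refine ⟨Or.inr h, ?_⟩
          rintro (rfl | h')
          · exact hP.one_notMem (by simpa using h)
          · exact asymm _ h (by simpa using h')
        · rintro ⟨rfl | h, h'⟩
          · exact absurd (Or.inl rfl) h'
          · exact h
      le_antisymm := by
        rintro x y (rfl | hxy) (h | hyx)
        · rfl
        · rfl
        · exact h.symm
        · exact absurd (by simpa using hyx) (asymm _ hxy)
      le_total := by
        intro x y
        by_cases h : x = y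
        · exact Or.inl (Or.inl h)
        · rcases hP.mem_or_inv_mem (x⁻¹ * y) (Subgroup.mem_top _)
            (fun h' => h (inv_mul_eq_one.1 h')) with h' | h'
          · exact Or.inl (Or.inr h')
          · exact Or.inr (Or.inr (by simpa using h'))
      toDecidableLE := Classical.decRel _ }
  refine ⟨o, ?_, fun x y => Iff.rfl⟩
  intro x y hxy z
  refine ⟨?_, ?_⟩
  · change (x * z)⁻¹ * (y * z) ∈ P
    have := hP.conj_mem z⁻¹ (Subgroup.mem_top _) _ hxy
    simpa [mul_assoc] using this
  · change (z * x)⁻¹ * (z * y) ∈ P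
    have h : x⁻¹ * y ∈ P := hxy
    simpa [mul_assoc] using h

end IsPositiveCone

theorem isPositiveCone_of_isFullOrder {G : Type*} [Group G] [LinearOrder G] (h : IsFullOrder G) :
    IsPositiveCone (⊤ : Subgroup G) {x | 1 < x} where
  subset _ _ := Subgroup.mem_top _
  one_notMem := lt_irrefl _
  mul_mem x hx y hy := by
    have h1 : 1 * y < x * y := (h 1 x hx y).1
    rw [one_mul] at h1
    exact lt_trans hy h1
  conj_mem g _ x hx := by
    have h1 : g * 1 < g * x := (h 1 x hx g).2
    have h2 := (h _ _ h1 g⁻¹).1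
    simpa using h2
  mem_or_inv_mem g _ hg := by
    rcases lt_or_gt_of_ne hg with h1 | h1
    · have := (h _ _ h1 g⁻¹).1
      exact Or.inr (by simpa using this)
    · exact Or.inl h1

/-! ### Torsion-free nilpotent groups are orderable -/

/-- The only element of finite order is `1`. -/
def TorsionFree (G : Type*) [Group G] : Prop :=
  ∀ (g : G) (n : ℕ), n ≠ 0 → g ^ n = 1 → g = 1

theorem TorsionFree.of_injective {G K : Type*} [Group G] [Group K] (hK : TorsionFree K)
    (f : G →* K) (hf : Function.Injective f) : TorsionFree G := by
  intro g n hn hg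
  refine (map_eq_one_iff f hf).1 (hK _ n hn ?_)
  rw [← map_pow, hg, map_one]

/-- A torsion-free abelian group embeds in its divisible hull, a rational vector space, which is
ordered lexicographically by coordinates in a well-ordered basis. -/
theorem TorsionFree.exists_isPositiveCone_of_comm {G : Type*} [CommGroup G] (hG : TorsionFree G) :
    ∃ P : Set G, IsPositiveCone (⊤ : Subgroup G) P := by
  classical
  have tf : IsAddTorsionFree (Additive G) := by
    refine ⟨fun n hn a b hab => ?_⟩
    have h1 : n • (a - b) = 0 := by
      rw [nsmul_sub]; exact sub_eq_zero.2 hab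
    have h2 := hG (Additive.toMul (a - b)) n hn (by rw [← toMul_nsmul, h1, toMul_zero])
    exact sub_eq_zero.1 (Additive.toMul.injective h2)
  let b := Module.Basis.ofVectorSpace ℚ (DivisibleHull (Additive G))
  let _ : LinearOrder (Module.Basis.ofVectorSpaceIndex ℚ (DivisibleHull (Additive G))) :=
    linearOrderOfSTO WellOrderingRel
  let f : Additive G →+ Lex (Module.Basis.ofVectorSpaceIndex ℚ (DivisibleHull (Additive G)) →₀ ℚ) :=
    { toFun := fun g => toLex (b.repr (DivisibleHull.coeAddMonoidHom (Additive G) g))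
      map_zero' := by simp
      map_add' := fun x y => by simp }
  have hf : Function.Injective f := fun x y hxy =>
    DivisibleHull.coe_injective (b.repr.injective (toLex.injective hxy))
  refine ⟨{g | 0 < f (Additive.ofMul g)}, ⟨fun _ _ => Subgroup.mem_top _, ?_, ?_, ?_, ?_⟩⟩
  · simp
  · intro x hx y hy
    simpa using add_pos hx hy
  · intro h _ x hx
    simpa using hx
  · intro h _ h1
    have : f (Additive.ofMul h) ≠ 0 := by
      rw [Ne, map_eq_zero_iff f hf]; simpa using h1
    rcases lt_or_gt_of_ne this with h2 | h2
    · right; simpa using h2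
    · left; exact h2

theorem commutatorElement_pow_left {G : Type*} [Group G] {x y : G} (h : Commute ⁅x, y⁆ x) (n : ℕ) :
    ⁅x ^ n, y⁆ = ⁅x, y⁆ ^ n := by
  have h1 : y * x⁻¹ * y⁻¹ = x⁻¹ * ⁅x, y⁆ := by rw [commutatorElement_def]; group
  have h2 : y * (x ^ n)⁻¹ * y⁻¹ = (x ^ n)⁻¹ * ⁅x, y⁆ ^ n := by
    rw [← inv_pow, ← conj_pow, h1, h.symm.inv_left.mul_pow]
  calc ⁅x ^ n, y⁆ = x ^ n * (y * (x ^ n)⁻¹ * y⁻¹) := by rw [commutatorElement_def]; group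
    _ = _ := by rw [h2, mul_inv_cancel_left]

-- The factors of the upper central series inherit torsion-freeness from the centre: modulo the
-- `i`-th term, `⁅x, y⁆ ^ n = ⁅x ^ n, y⁆` when `⁅x, y⁆` lies in the next term, so roots are pushed
-- one level down through commutators.
open Subgroup in
theorem TorsionFree.mem_upperCentralSeries {G : Type*} [Group G] (hG : TorsionFree G) {n : ℕ}
    (hn : n ≠ 0) (i : ℕ) : ∀ x ∈ Subgroup.upperCentralSeries G (i + 1),
      x ^ n ∈ Subgroup.upperCentralSeries G i → x ∈ Subgroup.upperCentralSeries G i := by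
  induction i with
  | zero =>
    intro x _ hx
    rw [Subgroup.upperCentralSeries_zero, mem_bot] at hx ⊢
    exact hG x n hn hx
  | succ i ih =>
    intro x hx hxn
    rw [Subgroup.mem_upperCentralSeries_succ_iff] at hx hxn ⊢
    intro y
    refine ih _ (hx y) ?_
    let π := QuotientGroup.mk' (Subgroup.upperCentralSeries G i)
    have hc : Commute ⁅π x, π y⁆ (π x) := by
      rw [← commutatorElement_eq_one_iff_commute, ← map_commutatorElement, ← map_commutatorElement]
      exact (QuotientGroup.eq_one_iff _).2 (Subgroup.mem_upperCentralSeries_succ_iff.1 (hx y) x)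
    have h := commutatorElement_pow_left hc n
    rw [← map_pow, ← map_commutatorElement, ← map_commutatorElement, ← map_pow] at h
    rw [← QuotientGroup.eq_one_iff]
    exact h.symm.trans ((QuotientGroup.eq_one_iff _).2 (hxn y))

open Subgroup in
theorem TorsionFree.quotient_center {G : Type*} [Group G] [hN : Group.IsNilpotent G]
    (hG : TorsionFree G) : TorsionFree (G ⧸ center G) := by
  intro g n hn hg
  induction g using QuotientGroup.induction_on with
  | H x =>
    rw [← QuotientGroup.mk_pow, QuotientGroup.eq_one_iff] at hg
    rw [QuotientGroup.eq_one_iff]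
    rw [← Subgroup.upperCentralSeries_one] at hg ⊢
    obtain ⟨c, hc⟩ := hN.nilpotent
    -- A root of a central element descends through the upper central series from the whole group to
    -- the centre.
    have key : ∀ j, x ∈ Subgroup.upperCentralSeries G (1 + j) →
        x ∈ Subgroup.upperCentralSeries G 1 := by
      intro j
      induction j with
      | zero => exact id
      | succ j ih =>
        intro hx
        exact ih (hG.mem_upperCentralSeries hn _ x hx
          (Subgroup.upperCentralSeries_mono G (Nat.le_add_right 1 j) hg))
    exact key c (Subgroup.upperCentralSeries_mono G (Nat.le_add_left c 1) (hc ▸ mem_top x))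

-- Lexicographic extension. Conjugation fixes the centre pointwise, so any order of the centre is
-- invariant.
open Subgroup in
theorem IsPositiveCone.of_center {G : Type*} [Group G] {P : Set (G ⧸ center G)}
    (hP : IsPositiveCone ⊤ P) {Q : Set (center G)} (hQ : IsPositiveCone ⊤ Q) :
    IsPositiveCone (⊤ : Subgroup G)
      {g | (g : G ⧸ center G) ∈ P ∨ ∃ h : g ∈ center G, ⟨g, h⟩ ∈ Q} where
  subset _ _ := mem_top _
  one_notMem := by
    rintro (h | ⟨h, h'⟩)
    · exact hP.one_notMem h
    · exact hQ.one_notMem h'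
  mul_mem := by
    rintro x (hx | ⟨hx, hx'⟩) y (hy | ⟨hy, hy'⟩)
    · exact Or.inl (hP.mul_mem _ hx _ hy)
    · left
      rwa [QuotientGroup.mk_mul, (QuotientGroup.eq_one_iff y).2 hy, mul_one]
    · left
      rwa [QuotientGroup.mk_mul, (QuotientGroup.eq_one_iff x).2 hx, one_mul]
    · exact Or.inr ⟨(center G).mul_mem hx hy, hQ.mul_mem _ hx' _ hy'⟩
  conj_mem := by
    rintro h - x (hx | ⟨hx, hx'⟩)
    · exact Or.inl (hP.conj_mem h (mem_top _) _ hx)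
    · right
      have : h * x * h⁻¹ = x := by rw [mem_center_iff.1 hx h, mul_inv_cancel_right]
      simpa only [this] using (⟨hx, hx'⟩ : ∃ h : x ∈ center G, ⟨x, h⟩ ∈ Q)
  mem_or_inv_mem := by
    intro g _ hg
    by_cases hz : g ∈ center G
    · rcases hQ.mem_or_inv_mem ⟨g, hz⟩ (mem_top _) (by simpa [Subtype.ext_iff] using hg) with h | h
      · exact Or.inl (Or.inr ⟨hz, h⟩)
      · exact Or.inr (Or.inr ⟨inv_mem hz, h⟩)
    · rcases hP.mem_or_inv_mem g (mem_top _)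
        (fun h => hz ((QuotientGroup.eq_one_iff g).1 h)) with h | h
      · exact Or.inl (Or.inl h)
      · exact Or.inr (Or.inl h)

open Subgroup in
theorem TorsionFree.exists_isPositiveCone {G : Type*} [Group G] [Group.IsNilpotent G]
    (hG : TorsionFree G) : ∃ P : Set G, IsPositiveCone (⊤ : Subgroup G) P := by
  revert hG
  apply Group.nilpotent_center_quotient_ind
    (P := fun G _ _ => TorsionFree G → ∃ P : Set G, IsPositiveCone (⊤ : Subgroup G) P)
  · intro G _ _ _
    exact ⟨∅, ⟨by simp, by simp, by simp, by simp, fun h _ h1 => absurd (Subsingleton.elim h 1) h1⟩⟩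
  · intro G _ _ ih hG
    let _ : CommGroup (center G) := { mul_comm := fun a b => Subtype.ext (mem_center_iff.1 b.2 a) }
    obtain ⟨P, hP⟩ := ih hG.quotient_center
    obtain ⟨Q, hQ⟩ := TorsionFree.exists_isPositiveCone_of_comm (G := center G)
      (hG.of_injective (center G).subtype Subtype.val_injective)
    exact ⟨_, hP.of_center hQ⟩

/-! ### Central filtrations -/

/-- A descending filtration of a group that is compatible with commutators. -/
structure IsCentralFiltration {G : Type*} [Group G] (Γ : ℕ → Subgroup G) : Prop where
  antitone : Antitone Γ
  zero : Γ 0 = ⊤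
  commutator_mem : ∀ {i j : ℕ} {g h : G}, g ∈ Γ i → h ∈ Γ j → ⁅g, h⁆ ∈ Γ (i + j)

namespace IsCentralFiltration

variable {G : Type*} [Group G] {Γ : ℕ → Subgroup G}

theorem normal (hΓ : IsCentralFiltration Γ) (n : ℕ) : (Γ n).Normal := by
  refine ⟨fun g hg h => ?_⟩
  have h1 : ⁅h, g⁆ ∈ Γ n := by
    have := hΓ.commutator_mem (i := 0) (hΓ.zero ▸ Subgroup.mem_top h) hg
    rwa [zero_add] at this
  have h2 := (Γ n).mul_mem h1 hg
  rwa [commutatorElement_def, inv_mul_cancel_right] at h2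

theorem mk_commute (hΓ : IsCentralFiltration Γ) {i j n : ℕ} {g h : G} (hg : g ∈ Γ i)
    (hh : h ∈ Γ j) (hn : n ≤ i + j) [(Γ n).Normal] : Commute (g : G ⧸ Γ n) (h : G ⧸ Γ n) := by
  rw [← commutatorElement_eq_one_iff_commute]
  exact (QuotientGroup.eq_one_iff (N := Γ n) ⁅g, h⁆).2 (hΓ.antitone hn (hΓ.commutator_mem hg hh))

/-- An endomorphism that moves every term of the filtration by elements of a deeper term maps
each term onto itself if the filtration terminates. -/
theorem exists_apply_eq (hΓ : IsCentralFiltration Γ) {c d : ℕ} (hc : Γ (c + 1) = ⊥) (hd : 1 ≤ d)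
    {σ : G →* G} (hσ : ∀ n, ∀ g ∈ Γ n, σ g * g⁻¹ ∈ Γ (n + d)) :
    ∀ m n : ℕ, c + 1 ≤ n + m → ∀ g ∈ Γ n, ∃ h ∈ Γ n, σ h = g := by
  intro m
  induction m with
  | zero =>
    intro n hn g hg
    have h1 := hΓ.antitone hn hg
    rw [hc, Subgroup.mem_bot] at h1
    subst h1
    exact ⟨1, hg, map_one σ⟩
  | succ m ih =>
    intro n hn g hg
    obtain ⟨v, hv, hv'⟩ := ih (n + 1) (by lia) (σ g * g⁻¹)
      (hΓ.antitone (by lia) (hσ n g hg))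
    -- As `σ v = σ g * g⁻¹`, the element `v⁻¹ * g` is mapped to `g`.
    refine ⟨v⁻¹ * g, (Γ n).mul_mem ((Γ n).inv_mem (hΓ.antitone (Nat.le_succ n) hv)) hg, ?_⟩
    rw [map_mul, map_inv, hv']
    group

/-- An element of the kernel lying in `Γ n` lies in `Γ (n + d)`, so it sinks to the trivial term. -/
theorem injective (hΓ : IsCentralFiltration Γ) {c d : ℕ} (hc : Γ (c + 1) = ⊥) (hd : 1 ≤ d)
    {σ : G →* G} (hσ : ∀ n, ∀ g ∈ Γ n, σ g * g⁻¹ ∈ Γ (n + d)) : Function.Injective σ := by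
  rw [injective_iff_map_eq_one]
  intro g hg
  have key : ∀ n, g ∈ Γ n := by
    intro n
    induction n with
    | zero => rw [hΓ.zero]; exact Subgroup.mem_top g
    | succ n ih =>
      have h1 := hσ n g ih
      rw [hg, one_mul, Subgroup.inv_mem_iff] at h1
      exact hΓ.antitone (by lia) h1
  have := key (c + 1)
  rwa [hc, Subgroup.mem_bot] at this

theorem surjective (hΓ : IsCentralFiltration Γ) {c d : ℕ} (hc : Γ (c + 1) = ⊥) (hd : 1 ≤ d)
    {σ : G →* G} (hσ : ∀ n, ∀ g ∈ Γ n, σ g * g⁻¹ ∈ Γ (n + d)) : Function.Surjective σ := by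
  intro g
  obtain ⟨h, -, hh⟩ := hΓ.exists_apply_eq hc hd hσ (c + 1) 0 (by lia) g
    (hΓ.zero ▸ Subgroup.mem_top g)
  exact ⟨h, hh⟩

/-- The automorphisms that move every term of a terminating filtration by elements of the term
`d` steps deeper. -/
def unipotentAut (hΓ : IsCentralFiltration Γ) {c d : ℕ} (hc : Γ (c + 1) = ⊥) (hd : 1 ≤ d) :
    Subgroup (MulAut G) where
  carrier := {σ | ∀ n, ∀ g ∈ Γ n, σ g * g⁻¹ ∈ Γ (n + d)}
  one_mem' := by
    intro n g _
    simp only [MulAut.one_apply, mul_inv_cancel]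
    exact (Γ _).one_mem
  mul_mem' := by
    intro σ τ hσ hτ n g hg
    have h1 : τ g ∈ Γ n := by
      have := (Γ n).mul_mem (hΓ.antitone (Nat.le_add_right n d) (hτ n g hg)) hg
      rwa [inv_mul_cancel_right] at this
    have := (Γ _).mul_mem (hσ n _ h1) (hτ n g hg)
    rwa [mul_assoc, inv_mul_cancel_left] at this
  inv_mem' := by
    intro σ hσ n g hg
    obtain ⟨h, hh, rfl⟩ := hΓ.exists_apply_eq (σ := σ.toMonoidHom) hc hd hσ (c + 1) n (by lia) g hg
    have h1 := (Γ _).inv_mem (hσ n h hh)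
    have h2 : σ⁻¹ (σ.toMonoidHom h) = h := σ.symm_apply_apply h
    rw [h2]
    simpa using h1

end IsCentralFiltration

/-- The filtration of a semidirect product in which the complement has weight `d`. -/
def semidirectFiltration {G C : Type*} [Group G] [CommGroup C] (φ : C →* MulAut G)
    (Γ : ℕ → Subgroup G) (d : ℕ) (h : ∀ t n, ∀ g ∈ Γ n, φ t g ∈ Γ n) (n : ℕ) :
    Subgroup (G ⋊[φ] C) where
  carrier := {p | p.left ∈ Γ n ∧ (n ≤ d ∨ p.right = 1)}
  one_mem' := ⟨(Γ n).one_mem, Or.inr rfl⟩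
  mul_mem' := by
    rintro p q ⟨hp, hp'⟩ ⟨hq, hq'⟩
    refine ⟨(Γ n).mul_mem hp (h _ _ _ hq), ?_⟩
    rcases hp' with hp' | hp'
    · exact Or.inl hp'
    · rcases hq' with hq' | hq'
      · exact Or.inl hq'
      · exact Or.inr (by simp [hp', hq'])
  inv_mem' := by
    rintro p ⟨hp, hp'⟩
    refine ⟨h _ _ _ ((Γ n).inv_mem hp), hp'.imp id (fun hp' => by simp [hp'])⟩

/-- Modulo the term of index `i + j` both actions occurring in the commutator become trivial: either
the acting element is `1`, or its side has weight at most `d` and the action shifts by `d`. What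
remains is a commutator in `G`. -/
theorem IsCentralFiltration.semidirect {G C : Type*} [Group G] [CommGroup C] {φ : C →* MulAut G}
    {Γ : ℕ → Subgroup G} (hΓ : IsCentralFiltration Γ) {d : ℕ}
    (hφ : ∀ t n, ∀ g ∈ Γ n, φ t g * g⁻¹ ∈ Γ (n + d)) (h : ∀ t n, ∀ g ∈ Γ n, φ t g ∈ Γ n) :
    IsCentralFiltration (semidirectFiltration φ Γ d h) where
  antitone m n hmn p hp := ⟨hΓ.antitone hmn hp.1, hp.2.imp (hmn.trans) id⟩
  zero := by
    refine eq_top_iff.2 fun p _ => ⟨hΓ.zero ▸ Subgroup.mem_top _, Or.inl (Nat.zero_le _)⟩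
  commutator_mem := by
    rintro i j p q ⟨hm, ht⟩ ⟨hm', ht'⟩
    have hright : ⁅p, q⁆.right = 1 := by
      simp only [commutatorElement_def, SemidirectProduct.mul_right, SemidirectProduct.inv_right]
      rw [mul_comm p.right, mul_inv_cancel_right, mul_inv_cancel]
    have hleft : ⁅p, q⁆.left
        = p.left * φ p.right q.left * (φ q.right p.left)⁻¹ * q.left⁻¹ := by
      have h1 : p.right * q.right * p.right⁻¹ = q.right := by
        rw [mul_comm p.right, mul_inv_cancel_right]
      simp only [commutatorElement_def, SemidirectProduct.mul_left, SemidirectProduct.mul_right,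
        SemidirectProduct.inv_left, SemidirectProduct.inv_right, ← MulAut.mul_apply, ← map_mul, h1]
      simp
    have key : ∀ {i j : ℕ} {s : C} {g : G}, (i ≤ d ∨ s = 1) → g ∈ Γ j →
        φ s g * g⁻¹ ∈ Γ (i + j) := by
      rintro i j s g (hi | rfl) hg
      · exact hΓ.antitone (by lia) (hφ s j g hg)
      · simp only [map_one, MulAut.one_apply, mul_inv_cancel]
        exact (Γ _).one_mem
    refine ⟨?_, Or.inr hright⟩
    rw [hleft]
    have := hΓ.normal (i + j)
    have h1 : ((φ p.right q.left : G) : G ⧸ Γ (i + j)) = q.left := by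
      rw [← mul_inv_eq_one]; exact (QuotientGroup.eq_one_iff (N := Γ (i + j)) _).2 (key ht hm')
    have h2 : ((φ q.right p.left : G) : G ⧸ Γ (i + j)) = p.left := by
      rw [← mul_inv_eq_one]
      exact (QuotientGroup.eq_one_iff (N := Γ (i + j)) _).2 (add_comm i j ▸ key ht' hm)
    rw [← QuotientGroup.eq_one_iff]
    simp only [QuotientGroup.mk_mul, QuotientGroup.mk_inv, h1, h2]
    exact (hΓ.mk_commute hm hm' le_rfl).commutator_eq

/-! ### The filtration generated by weighted elements -/

/-- Membership in the least filtration compatible with commutators in which every `f x` has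
weight at least `w x`. -/
inductive WeightedMem {X G : Type*} [Group G] (f : X → G) (w : X → ℕ) : ℕ → G → Prop
  | of (x : X) : WeightedMem f w (w x) (f x)
  | one (n : ℕ) : WeightedMem f w n 1
  | mul {n : ℕ} {g h : G} : WeightedMem f w n g → WeightedMem f w n h → WeightedMem f w n (g * h)
  | inv {n : ℕ} {g : G} : WeightedMem f w n g → WeightedMem f w n g⁻¹
  | comm {i j : ℕ} {g h : G} :
      WeightedMem f w i g → WeightedMem f w j h → WeightedMem f w (i + j) ⁅g, h⁆
  | mono {i j : ℕ} {g : G} : i ≤ j → WeightedMem f w j g → WeightedMem f w i g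

/-- The least filtration compatible with commutators in which every `f x` has weight at least
`w x`. -/
def weightedFiltration {X G : Type*} [Group G] (f : X → G) (w : X → ℕ) (n : ℕ) : Subgroup G where
  carrier := {g | WeightedMem f w n g}
  one_mem' := .one n
  mul_mem' := .mul
  inv_mem' := .inv

theorem isCentralFiltration_weightedFiltration {X G : Type*} [Group G] {f : X → G} {w : X → ℕ}
    (hf : Subgroup.closure (Set.range f) = ⊤) : IsCentralFiltration (weightedFiltration f w) where
  antitone _ _ hij _ hg := .mono hij hg
  zero := by
    rw [eq_top_iff, ← hf, Subgroup.closure_le]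
    rintro _ ⟨x, rfl⟩
    exact .mono (Nat.zero_le _) (.of x)
  commutator_mem := .comm

theorem map_mem_of_weightedMem {X G H : Type*} [Group G] [Group H] {f : X → G} {w : X → ℕ}
    {Δ : ℕ → Subgroup H} (hΔ : IsCentralFiltration Δ) {φ : G →* H} (hφ : ∀ x, φ (f x) ∈ Δ (w x))
    {n : ℕ} {g : G} (hg : WeightedMem f w n g) : φ g ∈ Δ n := by
  induction hg with
  | of x => exact hφ x
  | one n => rw [map_one]; exact (Δ n).one_mem
  | mul _ _ h1 h2 => rw [map_mul]; exact (Δ _).mul_mem h1 h2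
  | inv _ h => rw [map_inv]; exact (Δ _).inv_mem h
  | comm _ _ h1 h2 => rw [map_commutatorElement]; exact hΔ.commutator_mem h1 h2
  | mono hij _ h => exact hΔ.antitone hij h

theorem exists_weightedMem_of_map {X G H : Type*} [Group G] [Group H] {f : X → G} {w : X → ℕ}
    (φ : G →* H) {n : ℕ} {h : H} (hh : WeightedMem (fun x => φ (f x)) w n h) :
    ∃ g, WeightedMem f w n g ∧ φ g = h := by
  induction hh with
  | of x => exact ⟨f x, .of x, rfl⟩
  | one n => exact ⟨1, .one n, map_one φ⟩
  | mul _ _ h1 h2 =>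
    obtain ⟨a, ha, rfl⟩ := h1
    obtain ⟨b, hb, rfl⟩ := h2
    exact ⟨a * b, .mul ha hb, map_mul φ a b⟩
  | inv _ h1 =>
    obtain ⟨a, ha, rfl⟩ := h1
    exact ⟨a⁻¹, .inv ha, map_inv φ a⟩
  | comm _ _ h1 h2 =>
    obtain ⟨a, ha, rfl⟩ := h1
    obtain ⟨b, hb, rfl⟩ := h2
    exact ⟨⁅a, b⁆, .comm ha hb, map_commutatorElement φ a b⟩
  | mono hij _ h1 =>
    obtain ⟨a, ha, rfl⟩ := h1
    exact ⟨a, .mono hij ha, rfl⟩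

/-- An endomorphism that moves the generators by elements `d` steps deeper does so for all
elements. -/
theorem map_mul_inv_mem_of_weightedMem {X G : Type*} [Group G] {f : X → G} {w : X → ℕ}
    (hf : Subgroup.closure (Set.range f) = ⊤) {d : ℕ} {σ : G →* G}
    (hσ : ∀ x, σ (f x) * (f x)⁻¹ ∈ weightedFiltration f w (w x + d)) {n : ℕ} {g : G}
    (hg : WeightedMem f w n g) : σ g * g⁻¹ ∈ weightedFiltration f w (n + d) := by
  have hΓ := isCentralFiltration_weightedFiltration (w := w) hf
  set Γ := weightedFiltration f w
  induction hg with
  | of x => exact hσ x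
  | one n => simp only [map_one, inv_one, mul_one]; exact (Γ _).one_mem
  | @mul n g h _ _ h1 h2 =>
    have h3 := (Γ _).mul_mem h1 ((hΓ.normal _).conj_mem _ h2 g)
    convert h3 using 1
    rw [map_mul]
    group
  | @inv n g _ h1 =>
    have h3 := (hΓ.normal _).conj_mem _ ((Γ _).inv_mem h1) g⁻¹
    convert h3 using 1
    rw [map_inv]
    group
  | @comm i j g h hg hh h1 h2 =>
    have := hΓ.normal (i + j + d)
    obtain ⟨u, hu, hu'⟩ : ∃ u ∈ Γ (i + d), σ g = u * g := ⟨_, h1, by group⟩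
    obtain ⟨v, hv, hv'⟩ : ∃ v ∈ Γ (j + d), σ h = v * h := ⟨_, h2, by group⟩
    have hg' : g ∈ Γ i := hg
    have hh' : h ∈ Γ j := hh
    have hvh : v * h ∈ Γ j := (Γ j).mul_mem (hΓ.antitone (Nat.le_add_right j d) hv) hh'
    -- Modulo depth `i + j + d`, the errors `u` and `v` commute with everything they meet, so `⁅u *
    -- g, v * h⁆` collapses to `⁅g, h⁆`.
    have c1 : Commute (u : G ⧸ Γ (i + j + d)) ((v * h : G) : G ⧸ Γ (i + j + d)) :=
      hΓ.mk_commute hu hvh (by lia)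
    have c2 : Commute (v : G ⧸ Γ (i + j + d)) (g : G ⧸ Γ (i + j + d)) :=
      hΓ.mk_commute hv hg' (by lia)
    have c3 : Commute (v : G ⧸ Γ (i + j + d)) (⁅g, h⁆ : G) :=
      hΓ.mk_commute hv (hΓ.commutator_mem hg' hh') (by lia)
    have c4 : Commute (u : G ⧸ Γ (i + j + d)) (⁅g, h⁆ : G) :=
      hΓ.mk_commute hu (hΓ.commutator_mem hg' hh') (by lia)
    rw [← QuotientGroup.eq_one_iff]
    rw [map_commutatorElement, hu', hv']
    let π := QuotientGroup.mk' (Γ (i + j + d))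
    change π (⁅u * g, v * h⁆ * ⁅g, h⁆⁻¹) = 1
    replace c1 : Commute (π u) (π (v * h)) := c1
    replace c2 : Commute (π v) (π g) := c2
    replace c3 : Commute (π v) (π ⁅g, h⁆) := c3
    replace c4 : Commute (π u) (π ⁅g, h⁆) := c4
    rw [map_mul, map_inv, mul_inv_eq_one, map_commutatorElement, map_mul π u g,
      commutatorElement_mul_left_eq_conj_mul, c1.commutator_eq, mul_one, map_mul π v h,
      commutatorElement_mul_right_eq_mul_conj, c2.symm.commutator_eq, one_mul]
    rw [← map_commutatorElement, c3.eq, mul_inv_cancel_right, c4.eq, mul_inv_cancel_right]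
  | mono hij _ h => exact hΓ.antitone (Nat.add_le_add_right hij d) h

/-! ### Weighted free nilpotent groups -/

instance weightedFiltration_freeGroup_normal {X : Type*} (w : X → ℕ) (n : ℕ) :
    (weightedFiltration (FreeGroup.of : X → FreeGroup X) w n).Normal :=
  (isCentralFiltration_weightedFiltration (FreeGroup.closure_range_of X)).normal n

/-- The free object among groups with a filtration of length `c` generated by elements `x` of
weight `w x`. -/
abbrev WeightedNilpotent {X : Type*} (w : X → ℕ) (c : ℕ) : Type _ :=
  FreeGroup X ⧸ weightedFiltration (FreeGroup.of : X → FreeGroup X) w (c + 1)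

namespace WeightedNilpotent

variable {X : Type*} {w : X → ℕ} {c : ℕ}

/-- The canonical generators. -/
def of (w : X → ℕ) (c : ℕ) (x : X) : WeightedNilpotent w c :=
  QuotientGroup.mk' _ (FreeGroup.of x)

theorem closure_range_of : Subgroup.closure (Set.range (of w c)) = ⊤ := by
  have h : Set.range (of w c) =
      QuotientGroup.mk' _ '' Set.range (FreeGroup.of : X → FreeGroup X) := by
    rw [← Set.range_comp]; rfl
  rw [h, ← MonoidHom.map_closure, FreeGroup.closure_range_of,
    Subgroup.map_top_of_surjective _ (QuotientGroup.mk'_surjective _)]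

/-- The canonical filtration. -/
abbrev filtration (w : X → ℕ) (c : ℕ) : ℕ → Subgroup (WeightedNilpotent w c) :=
  weightedFiltration (of w c) w

theorem isCentralFiltration : IsCentralFiltration (filtration w c) :=
  isCentralFiltration_weightedFiltration closure_range_of

theorem of_mem (x : X) : of w c x ∈ filtration w c (w x) := WeightedMem.of x

theorem filtration_eq_bot : filtration w c (c + 1) = ⊥ := by
  rw [Subgroup.eq_bot_iff_forall]
  intro h hh
  obtain ⟨g, hg, rfl⟩ := exists_weightedMem_of_map (f := FreeGroup.of) (QuotientGroup.mk' _) hh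
  exact (QuotientGroup.eq_one_iff g).2 hg

theorem hom_ext {G : Type*} [Group G] {φ ψ : WeightedNilpotent w c →* G}
    (h : ∀ x, φ (of w c x) = ψ (of w c x)) : φ = ψ := by
  refine MonoidHom.eq_of_eqOn_dense closure_range_of ?_
  rintro _ ⟨x, rfl⟩
  exact h x

section lift

variable {G : Type*} [Group G] {Δ : ℕ → Subgroup G} (hΔ : IsCentralFiltration Δ)
  (hc : Δ (c + 1) = ⊥) (f : X → G) (hf : ∀ x, f x ∈ Δ (w x))

/-- The universal property. -/
def lift : WeightedNilpotent w c →* G :=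
  QuotientGroup.lift _ (FreeGroup.lift f) fun g hg => by
    have h := map_mem_of_weightedMem (φ := FreeGroup.lift f) hΔ
      (by simpa using hf) hg
    rwa [hc, Subgroup.mem_bot] at h

@[simp]
theorem lift_of (x : X) : lift hΔ hc f hf (of w c x) = f x := by
  change FreeGroup.lift f (FreeGroup.of x) = f x
  simp

end lift

/-! ### Elimination of a generator -/

section elimination

variable (w c) (x : X)

/-- The weights after elimination of `x`: the pair `(i, y)` stands for the commutator of `y` with
`i` copies of `x`. -/
def elimWeight (p : ℕ × {y : X // y ≠ x}) : ℕ := w p.2 + p.1 * w x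

/-- Conjugation by the eliminated generator. -/
def elimEnd : WeightedNilpotent (elimWeight w x) c →* WeightedNilpotent (elimWeight w x) c :=
  lift isCentralFiltration filtration_eq_bot
    -- This is `x g x⁻¹ = g ⁅g⁻¹, x⁆`, where `⁅g⁻¹, x⁆` is the next iterated commutator.
    (fun p => of _ c p * of _ c (p.1 + 1, p.2)) fun p =>
      Subgroup.mul_mem _ (of_mem p) (isCentralFiltration.antitone
        (by simp only [elimWeight]; gcongr; exact Nat.le_succ _) (of_mem (p.1 + 1, p.2)))

theorem elimEnd_of (p : ℕ × {y : X // y ≠ x}) :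
    elimEnd w c x (of _ c p) = of _ c p * of _ c (p.1 + 1, p.2) := lift_of ..

theorem elimEnd_mul_inv_mem (n : ℕ) (g : WeightedNilpotent (elimWeight w x) c)
    (hg : g ∈ filtration (elimWeight w x) c n) :
    elimEnd w c x g * g⁻¹ ∈ filtration (elimWeight w x) c (n + w x) := by
  refine map_mul_inv_mem_of_weightedMem closure_range_of (fun p => ?_) hg
  rw [elimEnd_of]
  refine (isCentralFiltration.normal _).conj_mem _ ?_ _
  have : elimWeight w x p + w x = elimWeight w x (p.1 + 1, p.2) := by
    simp only [elimWeight]; ring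
  rw [this]
  exact of_mem _

variable {x} (hx : 1 ≤ w x)

/-- Conjugation by the eliminated generator as an automorphism. -/
noncomputable def elimAut : MulAut (WeightedNilpotent (elimWeight w x) c) :=
  MulEquiv.ofBijective (elimEnd w c x)
    ⟨isCentralFiltration.injective filtration_eq_bot hx (elimEnd_mul_inv_mem w c x),
      isCentralFiltration.surjective filtration_eq_bot hx (elimEnd_mul_inv_mem w c x)⟩

/-- The action of the infinite cyclic group generated by the eliminated generator. -/
noncomputable def elimAction : Multiplicative ℤ →* MulAut (WeightedNilpotent (elimWeight w x) c) :=
  zpowersHom _ (elimAut w c hx)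

theorem elimAction_mul_inv_mem (t : Multiplicative ℤ) (n : ℕ)
    (g : WeightedNilpotent (elimWeight w x) c) (hg : g ∈ filtration (elimWeight w x) c n) :
    elimAction w c hx t g * g⁻¹ ∈ filtration (elimWeight w x) c (n + w x) := by
  have h1 : elimAut w c hx ∈ isCentralFiltration.unipotentAut (filtration_eq_bot (c := c)) hx :=
    elimEnd_mul_inv_mem w c x
  have h2 : elimAction w c hx t ∈
      isCentralFiltration.unipotentAut (filtration_eq_bot (c := c)) hx := by
    rw [elimAction, zpowersHom_apply]
    exact Subgroup.zpow_mem _ h1 _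
  exact h2 n g hg

theorem elimAction_mem (t : Multiplicative ℤ) (n : ℕ)
    (g : WeightedNilpotent (elimWeight w x) c) (hg : g ∈ filtration (elimWeight w x) c n) :
    elimAction w c hx t g ∈ filtration (elimWeight w x) c n := by
  have h := Subgroup.mul_mem _ (isCentralFiltration.antitone (Nat.le_add_right n (w x))
    (elimAction_mul_inv_mem w c hx t n g hg)) hg
  rwa [inv_mul_cancel_right] at h

/-- The semidirect product of the group obtained by eliminating `x` with the infinite cyclic
group generated by `x`. -/
abbrev ElimProduct : Type _ :=
  WeightedNilpotent (elimWeight w x) c ⋊[elimAction w c hx] Multiplicative ℤ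

open Classical in
/-- The homomorphism that eliminates `x`. -/
noncomputable def toElimProduct (hxc : w x ≤ c) : WeightedNilpotent w c →* ElimProduct w c hx :=
  lift (isCentralFiltration.semidirect (d := w x) (elimAction_mul_inv_mem w c hx)
      (elimAction_mem w c hx))
    (by
      rw [Subgroup.eq_bot_iff_forall]
      -- Since `w x ≤ c`, the cyclic complement contributes nothing in weight `c + 1`.
      rintro p ⟨h1, h2 | h2⟩
      · lia
      · rw [filtration_eq_bot, Subgroup.mem_bot] at h1
        exact SemidirectProduct.ext h1 h2)
    (fun z => if h : z = x then SemidirectProduct.inr (Multiplicative.ofAdd 1)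
      else SemidirectProduct.inl (of _ c (0, ⟨z, h⟩)))
    (fun z => by
      split_ifs with h
      · subst h
        exact ⟨Subgroup.one_mem _, Or.inl le_rfl⟩
      · refine ⟨?_, Or.inr rfl⟩
        have : w z = elimWeight w x (0, ⟨z, h⟩) := by simp [elimWeight]
        rw [this]
        exact of_mem _)

/-- The iterated commutators that the pairs `(i, y)` stand for. -/
def iteratedCommutator (x : X) (p : ℕ × {y : X // y ≠ x}) : WeightedNilpotent w c :=
  Nat.rec (of w c p.2) (fun _ g => ⁅g⁻¹, of w c x⁆) p.1

theorem iteratedCommutator_mem (p : ℕ × {y : X // y ≠ x}) :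
    iteratedCommutator w c x p ∈ filtration w c (elimWeight w x p) := by
  obtain ⟨i, y⟩ := p
  induction i with
  | zero =>
    simp only [elimWeight, zero_mul, add_zero]
    exact of_mem _
  | succ i ih =>
    have : elimWeight w x (i + 1, y) = elimWeight w x (i, y) + w x := by
      simp only [elimWeight]; ring
    rw [this]
    exact isCentralFiltration.commutator_mem (Subgroup.inv_mem _ ih) (of_mem x)

/-- The inclusion of the group obtained by eliminating `x`. -/
def ofElim (x : X) : WeightedNilpotent (elimWeight w x) c →* WeightedNilpotent w c :=
  lift isCentralFiltration filtration_eq_bot (iteratedCommutator w c x)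
    (iteratedCommutator_mem w c)

theorem ofElim_of (p : ℕ × {y : X // y ≠ x}) :
    ofElim w c x (of _ c p) = iteratedCommutator w c x p := lift_of ..

theorem ofElim_elimAut (g : WeightedNilpotent (elimWeight w x) c) :
    ofElim w c x (elimAut w c hx g) = of w c x * ofElim w c x g * (of w c x)⁻¹ := by
  have : (ofElim w c x).comp (elimEnd w c x) =
      (MulAut.conj (of w c x)).toMonoidHom.comp (ofElim w c x) := by
    refine hom_ext fun p => ?_
    simp only [MonoidHom.comp_apply, elimEnd_of, map_mul, ofElim_of]
    change iteratedCommutator w c x p * ⁅(iteratedCommutator w c x p)⁻¹, of w c x⁆ =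
      of w c x * iteratedCommutator w c x p * (of w c x)⁻¹
    rw [commutatorElement_def]
    group
  exact DFunLike.congr_fun this g

theorem ofElim_zpow_elimAut (n : ℤ) : ∀ g : WeightedNilpotent (elimWeight w x) c,
    ofElim w c x ((elimAut w c hx ^ n) g) = of w c x ^ n * ofElim w c x g * (of w c x ^ n)⁻¹ := by
  induction n using Int.induction_on with
  | zero => simp
  | succ n ih =>
    intro g
    rw [zpow_add, zpow_one, MulAut.mul_apply, ih, ofElim_elimAut, zpow_add]
    group
  | pred n ih =>
    intro g
    have h := ofElim_elimAut w c hx ((elimAut w c hx)⁻¹ g)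
    rw [MulAut.apply_inv_self] at h
    rw [zpow_sub, zpow_one, MulAut.mul_apply, ih, h, zpow_sub]
    group

/-- The homomorphism from the semidirect product back to the original group. -/
noncomputable def ofElimProduct : ElimProduct w c hx →* WeightedNilpotent w c :=
  SemidirectProduct.lift (ofElim w c x) (zpowersHom _ (of w c x)) fun t => by
    refine MonoidHom.ext fun g => ?_
    exact ofElim_zpow_elimAut w c hx _ g

/-- `ofElimProduct` is a left inverse, as is seen on generators. -/
theorem toElimProduct_injective (hxc : w x ≤ c) :
    Function.Injective (toElimProduct w c hx hxc) := by
  have h : (ofElimProduct w c hx).comp (toElimProduct w c hx hxc) = MonoidHom.id _ := by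
    refine hom_ext fun z => ?_
    rw [MonoidHom.comp_apply, toElimProduct, lift_of]
    split_ifs with h
    · subst h
      simp [ofElimProduct]
    · rw [ofElimProduct, SemidirectProduct.lift_inl, ofElim_of]
      rfl
  exact Function.LeftInverse.injective (g := ofElimProduct w c hx) (DFunLike.congr_fun h)

end elimination

end WeightedNilpotent

/-! ### Torsion-freeness by repeated elimination. -/

theorem TorsionFree.semidirect {G C : Type*} [Group G] [Group C] (hG : TorsionFree G)
    (hC : TorsionFree C) (φ : C →* MulAut G) : TorsionFree (G ⋊[φ] C) := by
  intro p n hn hp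
  have h1 : p.right = 1 := hC _ n hn (by
    have := congrArg SemidirectProduct.rightHom hp
    rwa [map_pow, map_one] at this)
  have h2 : p = SemidirectProduct.inl p.left := by
    conv_lhs => rw [← SemidirectProduct.inl_left_mul_inr_right p, h1, map_one, mul_one]
  rw [h2, ← map_pow] at hp
  rw [h2, hG _ n hn (SemidirectProduct.inl_injective (hp.trans (map_one _).symm)), map_one]

theorem torsionFree_multiplicative_int : TorsionFree (Multiplicative ℤ) := by
  intro g n hn hg
  have h : (n : ℤ) * Multiplicative.toAdd g = 0 := by
    have := congrArg Multiplicative.toAdd hg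
    simpa using this
  rcases mul_eq_zero.1 h with h | h
  · exact absurd (by exact_mod_cast h) hn
  · exact Multiplicative.toAdd.injective h

/-- Double induction: on `m`, the distance of the weight bound `d` from `c + 1`, and on the number
of generators of weight exactly `d`. Eliminating one of these leaves one fewer, because a pair `(i,
y)` with `i > 0` has weight above `d`. Once all weights exceed `c` the group is trivial. Elimination
produces infinitely many generators, so finiteness is required only below each weight. -/
theorem WeightedNilpotent.torsionFree (c : ℕ) : ∀ m d : ℕ, d + m = c + 1 → 1 ≤ d →
    ∀ (X : Type) (w : X → ℕ), (∀ x, d ≤ w x) → (∀ j, {x | w x ≤ j}.Finite) →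
      TorsionFree (WeightedNilpotent w c) := by
  intro m
  induction m with
  | zero =>
    intro d hd _ X w hw _ g n _ _
    have h : Subgroup.closure (Set.range (of w c)) ≤ ⊥ := by
      rw [Subgroup.closure_le]
      rintro _ ⟨x, rfl⟩
      rw [SetLike.mem_coe, ← filtration_eq_bot]
      have := hw x
      exact isCentralFiltration.antitone (by lia) (of_mem x)
    rw [closure_range_of] at h
    exact (Subgroup.mem_bot).1 (h (Subgroup.mem_top g))
  | succ m ih =>
    intro d hd hd1 X w hw hfin
    obtain ⟨n, hn⟩ : ∃ n, {x | w x = d}.ncard = n := ⟨_, rfl⟩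
    induction n generalizing X w with
    | zero =>
      refine ih (d + 1) (by lia) (by lia) X w (fun x => ?_) hfin
      have hf : {x | w x = d}.Finite := (hfin d).subset fun x hx => le_of_eq hx
      rw [Set.ncard_eq_zero hf] at hn
      refine lt_of_le_of_ne (hw x) fun h => ?_
      have : x ∈ {x | w x = d} := h.symm
      rw [hn] at this
      exact this
    | succ n ihn =>
      have hf : {x | w x = d}.Finite := (hfin d).subset fun x hx => le_of_eq hx
      obtain ⟨x, hx⟩ : {x | w x = d}.Nonempty := by
        rw [← Set.ncard_pos hf]; lia
      have hx' : w x = d := hx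
      have hx1 : 1 ≤ w x := by lia
      refine TorsionFree.of_injective (TorsionFree.semidirect ?_ torsionFree_multiplicative_int _)
        (toElimProduct w c hx1 (by lia)) (toElimProduct_injective w c hx1 (by lia))
      refine ihn _ _ (fun p => (hw p.2).trans (Nat.le_add_right _ _)) (fun j => ?_) ?_
      · refine Set.Finite.subset (((Set.finite_Iic j).prod
          ((hfin j).preimage (Subtype.val_injective.injOn (s := Subtype.val ⁻¹' {x | w x ≤ j}))))) ?_
        rintro ⟨i, y⟩ hp
        simp only [Set.mem_ofPred_eq, elimWeight] at hp
        refine ⟨?_, ?_⟩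
        · exact (Nat.le_mul_of_pos_right i hx1).trans (by lia)
        · change w y ≤ j
          lia
      · have hp0 : ∀ p ∈ {p | elimWeight w x p = d}, p.1 = 0 ∧ w p.2 = d := by
          rintro ⟨i, y⟩ hp
          simp only [Set.mem_ofPred_eq, elimWeight] at hp
          have h1 := hw y
          have h2 := Nat.le_mul_of_pos_right i hx1
          refine ⟨by change i = 0; lia, by change w y = d; lia⟩
        have h1 : {p | elimWeight w x p = d}.ncard = ({x | w x = d} \ {x}).ncard := by
          refine Set.ncard_congr (fun p _ => p.2) (fun p hp => ⟨(hp0 p hp).2, p.2.2⟩) ?_ ?_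
          · intro p q hp hq hpq
            exact Prod.ext ((hp0 p hp).1.trans (hp0 q hq).1.symm) (Subtype.ext hpq)
          · rintro y ⟨hy, hyx⟩
            exact ⟨(0, ⟨y, hyx⟩), by simpa [elimWeight] using hy, rfl⟩
        rw [h1, Set.ncard_sdiff_singleton_of_mem hx, hn]
        rfl

/-! ### Free nilpotent groups -/

/-- Induction by the three subgroups lemma in the quotient by the target term. -/
theorem commutator_lowerCentralSeries_le {G : Type*} [Group G] (j : ℕ) : ∀ i : ℕ,
    ⁅(⊤ : Subgroup G).lowerCentralSeries j, (⊤ : Subgroup G).lowerCentralSeries i⁆ ≤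
      (⊤ : Subgroup G).lowerCentralSeries (i + j + 1) := by
  induction j with
  | zero => intro i; rw [Subgroup.commutator_comm]; exact le_rfl
  | succ j ih =>
    intro i
    let π := QuotientGroup.mk' ((⊤ : Subgroup G).lowerCentralSeries (i + (j + 1) + 1))
    have hker : ∀ H : Subgroup G, H ≤ (⊤ : Subgroup G).lowerCentralSeries (i + (j + 1) + 1) ↔
        H.map π = ⊥ := by
      intro H
      rw [Subgroup.map_eq_bot_iff, QuotientGroup.ker_mk']
    rw [hker]
    change Subgroup.map π ⁅⁅(⊤ : Subgroup G).lowerCentralSeries j, ⊤⁆, _⁆ = ⊥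
    rw [Subgroup.map_commutator, Subgroup.map_commutator]
    refine Subgroup.commutator_commutator_eq_bot_of_rotate ?_ ?_
    · rw [← Subgroup.map_commutator, ← Subgroup.map_commutator, ← hker, Subgroup.commutator_comm ⊤,
        ← Subgroup.lowerCentralSeries_succ, Subgroup.commutator_comm]
      exact (ih (i + 1)).trans (le_of_eq (by congr 1; lia))
    · rw [← Subgroup.map_commutator, ← Subgroup.map_commutator, ← hker]
      rw [Subgroup.commutator_comm ((⊤ : Subgroup G).lowerCentralSeries i)]
      exact Subgroup.commutator_mono (ih i) le_rfl

/-- Weight `n` corresponds to `γ_n`; by truncated subtraction weights `0` and `1` both give the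
whole group. -/
theorem isCentralFiltration_lowerCentralSeries (G : Type*) [Group G] :
    IsCentralFiltration fun n => (⊤ : Subgroup G).lowerCentralSeries (n - 1) where
  antitone _ _ h := Subgroup.lowerCentralSeries_antitone _ (by lia)
  zero := rfl
  commutator_mem {i j g h} hg hh := by
    have := commutator_lowerCentralSeries_le _ _ (Subgroup.commutator_mem_commutator hg hh)
    exact Subgroup.lowerCentralSeries_antitone _ (by lia) this

theorem weightedFiltration_one_eq_lowerCentralSeries (X : Type*) (c : ℕ) :
    weightedFiltration (FreeGroup.of : X → FreeGroup X) (fun _ => 1) (c + 1) =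
      (⊤ : Subgroup (FreeGroup X)).lowerCentralSeries c := by
  refine le_antisymm ?_ ?_
  · intro g hg
    exact map_mem_of_weightedMem (φ := MonoidHom.id _)
      (isCentralFiltration_lowerCentralSeries (FreeGroup X)) (fun x => Subgroup.mem_top _) hg
  · induction c with
    | zero =>
      rw [Subgroup.lowerCentralSeries_zero, ← FreeGroup.closure_range_of, Subgroup.closure_le]
      rintro _ ⟨x, rfl⟩
      exact WeightedMem.of x
    | succ c ih =>
      rw [Subgroup.lowerCentralSeries_succ, Subgroup.commutator_le]
      intro g hg h _
      have h1 : h ∈ weightedFiltration (FreeGroup.of : X → FreeGroup X) (fun _ => 1) 1 := by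
        have : Subgroup.closure (Set.range (FreeGroup.of : X → FreeGroup X)) ≤
            weightedFiltration (FreeGroup.of : X → FreeGroup X) (fun _ => 1) 1 := by
          rw [Subgroup.closure_le]
          rintro _ ⟨x, rfl⟩
          exact WeightedMem.of x
        rw [FreeGroup.closure_range_of] at this
        exact this (Subgroup.mem_top h)
      exact WeightedMem.comm (ih hg) h1

theorem torsionFree_freeNilpotentGroup (k c : ℕ) : TorsionFree (FreeNilpotentGroup k c) := by
  have h := WeightedNilpotent.torsionFree c c 1 (by lia) le_rfl (Fin k) (fun _ => 1)
    (fun _ => le_rfl) (fun j => Set.toFinite _)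
  exact h.of_injective (QuotientGroup.quotientMulEquivOfEq
    (weightedFiltration_one_eq_lowerCentralSeries (Fin k) c).symm).toMonoidHom
    (MulEquiv.injective _)

theorem lowerCentralSeries_freeNilpotentGroup (k c : ℕ) :
    (⊤ : Subgroup (FreeNilpotentGroup k c)).lowerCentralSeries c = ⊥ := by
  rw [← Subgroup.map_top_of_surjective _ (QuotientGroup.mk'_surjective
    ((⊤ : Subgroup (FreeGroup (Fin k))).lowerCentralSeries c)), ← Subgroup.map_lowerCentralSeries,
    Subgroup.map_eq_bot_iff, QuotientGroup.ker_mk']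

instance isNilpotent_freeNilpotentGroup (k c : ℕ) : Group.IsNilpotent (FreeNilpotentGroup k c) :=
  Subgroup.nilpotent_iff_lowerCentralSeries.2 ⟨c, lowerCentralSeries_freeNilpotentGroup k c⟩

theorem exists_isPositiveCone_freeNilpotentGroup (k c : ℕ) :
    ∃ P : Set (FreeNilpotentGroup k c), IsPositiveCone ⊤ P :=
  (torsionFree_freeNilpotentGroup k c).exists_isPositiveCone

/-! ### Free groups are residually nilpotent -/

section unitFiltration

variable {R : Type*} [Ring R] {I : ℕ → AddSubgroup R}

/-- The units congruent to `1` modulo `I n`. -/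
def unitFiltration (hI : Antitone I) (hmul : ∀ {a b x y}, x ∈ I a → y ∈ I b → x * y ∈ I (a + b))
    (n : ℕ) : Subgroup Rˣ where
  carrier := {u | (u : R) - 1 ∈ I n ∧ ((u⁻¹ : Rˣ) : R) - 1 ∈ I n}
  one_mem' := by simp
  mul_mem' := by
    have key : ∀ x y : R, x - 1 ∈ I n → y - 1 ∈ I n → x * y - 1 ∈ I n := by
      intro x y hx hy
      have : x * y - 1 = (x - 1) * (y - 1) + (x - 1) + (y - 1) := by noncomm_ring
      rw [this]
      exact add_mem (add_mem (hI (Nat.le_add_right n n) (hmul hx hy)) hx) hy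
    rintro u v ⟨hu, hu'⟩ ⟨hv, hv'⟩
    refine ⟨by simpa using key _ _ hu hv, by simpa using key _ _ hv' hu'⟩
  inv_mem' := by
    rintro u ⟨hu, hu'⟩
    exact ⟨hu', by simpa using hu⟩

/-- `⁅u, v⁆ - 1 = ((u - 1)(v - 1) - (v - 1)(u - 1)) u⁻¹ v⁻¹`, and the inverse of `⁅u, v⁆` is `⁅v,
u⁆`. -/
theorem commutator_mem_unitFiltration (hI : Antitone I)
    (hmul : ∀ {a b x y}, x ∈ I a → y ∈ I b → x * y ∈ I (a + b)) (hone : (1 : R) ∈ I 0)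
    {a b : ℕ} {u v : Rˣ} (hu : u ∈ unitFiltration hI hmul a) (hv : v ∈ unitFiltration hI hmul b) :
    ⁅u, v⁆ ∈ unitFiltration hI hmul (a + b) := by
  have key : ∀ {a b : ℕ} {u v : Rˣ}, u ∈ unitFiltration hI hmul a →
      v ∈ unitFiltration hI hmul b → ((⁅u, v⁆ : Rˣ) : R) - 1 ∈ I (a + b) := by
    intro a b u v hu hv
    have h1 : ((⁅u, v⁆ : Rˣ) : R) - 1 = (((u : R) - 1) * ((v : R) - 1) -
        ((v : R) - 1) * ((u : R) - 1)) * (((u⁻¹ : Rˣ) : R) * ((v⁻¹ : Rˣ) : R)) := by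
      have h2 : ((u : R) - 1) * ((v : R) - 1) - ((v : R) - 1) * ((u : R) - 1)
          = (u : R) * v - v * u := by noncomm_ring
      have h3 : (v : R) * u * (((u⁻¹ : Rˣ) : R) * ((v⁻¹ : Rˣ) : R)) = 1 := by
        norm_cast
        simp
      rw [h2, sub_mul, h3, commutatorElement_def]
      simp [mul_assoc]
    have mem0 : ∀ {n : ℕ} {x : R}, x - 1 ∈ I n → x ∈ I 0 := by
      intro n x hx
      have := add_mem (hI (Nat.zero_le n) hx) hone
      rwa [sub_add_cancel] at this
    rw [h1]
    have h4 := hmul (sub_mem (hmul hu.1 hv.1) (add_comm b a ▸ hmul hv.1 hu.1))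
      (hmul (mem0 hu.2) (mem0 hv.2))
    simpa using h4
  refine ⟨key hu hv, ?_⟩
  rw [commutatorElement_inv, add_comm]
  exact key hv hu

theorem isNilpotent_unitFiltration_one (hI : Antitone I)
    (hmul : ∀ {a b x y}, x ∈ I a → y ∈ I b → x * y ∈ I (a + b)) (hone : (1 : R) ∈ I 0) {n : ℕ}
    (hn : I (n + 1) = ⊥) : Group.IsNilpotent (unitFiltration hI hmul 1) := by
  have key : ∀ m, (unitFiltration hI hmul 1).lowerCentralSeries m ≤
      unitFiltration hI hmul (m + 1) := by
    intro m
    induction m with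
    | zero => exact le_rfl
    | succ m ih =>
      rw [Subgroup.lowerCentralSeries_succ, Subgroup.commutator_le]
      exact fun g hg h hh => commutator_mem_unitFiltration hI hmul hone (ih hg) hh
  refine Subgroup.isNilpotent_of_lowerCentralSeries_eq_bot (n := n) ?_
  rw [Subgroup.eq_bot_iff_forall]
  intro u hu
  have h1 := (key n hu).1
  rw [hn, AddSubgroup.mem_bot, sub_eq_zero] at h1
  exact Units.ext h1

end unitFiltration

/-- The matrices with nonzero entries only at distance at least `m` above the diagonal. -/
def upperBand (n m : ℕ) : AddSubgroup (Matrix (Fin n) (Fin n) ℤ) where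
  carrier := {M | ∀ a b : Fin n, b.val < a.val + m → M a b = 0}
  zero_mem' _ _ _ := rfl
  add_mem' hM hN a b h := by simp [hM a b h, hN a b h]
  neg_mem' hM a b h := by simp [hM a b h]

theorem upperBand_antitone (n : ℕ) : Antitone (upperBand n) :=
  fun _ _ h _ hM a b hab => hM a b (by lia)

theorem mul_mem_upperBand {n a b : ℕ} {M N : Matrix (Fin n) (Fin n) ℤ} (hM : M ∈ upperBand n a)
    (hN : N ∈ upperBand n b) : M * N ∈ upperBand n (a + b) := by
  intro i j hij
  rw [Matrix.mul_apply]
  refine Finset.sum_eq_zero fun k _ => ?_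
  by_cases h : k.val < i.val + a
  · rw [hM i k h, zero_mul]
  · rw [hN k j (by lia), mul_zero]

theorem one_mem_upperBand (n : ℕ) : (1 : Matrix (Fin n) (Fin n) ℤ) ∈ upperBand n 0 := by
  intro a b h
  exact Matrix.one_apply_ne (by rintro rfl; lia)

theorem upperBand_eq_bot (n : ℕ) : upperBand (n + 1) (n + 1) = ⊥ := by
  rw [eq_bot_iff]
  intro M hM
  rw [AddSubgroup.mem_bot]
  ext a b
  exact hM a b (by have := b.2; lia)

/-- The unit `1 + A` for `A` of square zero. -/
def unitOfSqZero {R : Type*} [Ring R] (A : R) (hA : A * A = 0) : Rˣ where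
  val := 1 + A
  inv := 1 - A
  val_inv := by rw [mul_sub, add_mul 1 A A, mul_one, hA]; simp
  inv_val := by rw [mul_add, sub_mul 1 A A, mul_one, hA]; simp

theorem val_unitOfSqZero_zpow {R : Type*} [Ring R] (A : R) (hA : A * A = 0) (e : ℤ) :
    ((unitOfSqZero A hA ^ e : Rˣ) : R) = 1 + e • A := by
  induction e using Int.induction_on with
  | zero => simp
  | succ n ih =>
    rw [zpow_add, zpow_one, Units.val_mul, ih]
    change (1 + (n : ℤ) • A) * (1 + A) = _
    rw [mul_add, add_mul _ _ A, mul_one, smul_mul_assoc, hA, add_smul]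
    simp [add_assoc]
  | pred n ih =>
    rw [zpow_sub, zpow_one, Units.val_mul, ih]
    change (1 + (-(n : ℤ)) • A) * (1 - A) = _
    rw [mul_sub, add_mul _ _ A, mul_one, smul_mul_assoc, hA, sub_smul]
    simp [add_sub_assoc]

/-- The normal form in the free product of infinite cyclic groups. -/
theorem exists_syllables {ι : Type*} (v : FreeGroup ι) :
    ∃ l : List (ι × ℤ), l.IsChain (fun p q => p.1 ≠ q.1) ∧ (∀ p ∈ l, p.2 ≠ 0) ∧
      v = (l.map fun p => FreeGroup.of p.1 ^ p.2).prod := by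
  classical
  let w := Monoid.CoprodI.Word.equiv (freeGroupEquivCoprodI v)
  have hw : w.prod = freeGroupEquivCoprodI v := Monoid.CoprodI.Word.equiv.symm_apply_apply _
  refine ⟨w.toList.map fun p => (p.1, FreeGroup.freeGroupUnitEquivInt p.2), ?_, ?_, ?_⟩
  · rw [List.isChain_map]
    exact w.chain_ne
  · intro p hp
    obtain ⟨q, hq, rfl⟩ := List.mem_map.1 hp
    intro h
    refine w.ne_one q hq (FreeGroup.freeGroupUnitEquivInt.injective ?_)
    refine (show FreeGroup.freeGroupUnitEquivInt q.2 = 0 from h).trans ?_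
    simp [FreeGroup.freeGroupUnitEquivInt]
  · have h1 : v = freeGroupEquivCoprodI.symm w.prod := by rw [hw, MulEquiv.symm_apply_apply]
    conv_lhs => rw [h1]
    rw [Monoid.CoprodI.Word.prod, map_list_prod, List.map_map, List.map_map]
    congr 1
    refine List.map_congr_left fun p _ => ?_
    have h2 : p.2 = FreeGroup.of () ^ FreeGroup.freeGroupUnitEquivInt p.2 :=
      (FreeGroup.freeGroupUnitEquivInt.symm_apply_apply p.2).symm
    simp only [Function.comp_apply]
    conv_lhs => rw [h2]
    simp

section syllableMatrix

variable (l : List (ℕ × ℤ))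

/-- The matrix that moves from position `a` to position `a + 1` if the syllable at position `a`
is a power of the `i`-th generator. -/
def syllableMatrix (i : ℕ) : Matrix (Fin (l.length + 1)) (Fin (l.length + 1)) ℤ :=
  Matrix.of fun a b => if b.val = a.val + 1 ∧ (l[a.val]?).map Prod.fst = some i then 1 else 0

variable {l}

/-- A nonzero entry would need two adjacent syllables in the same generator. -/
theorem syllableMatrix_mul_self (hl : l.IsChain (fun p q => p.1 ≠ q.1)) (i : ℕ) :
    syllableMatrix l i * syllableMatrix l i = 0 := by
  ext a b
  rw [Matrix.mul_apply]
  refine Finset.sum_eq_zero fun k _ => ?_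
  simp only [syllableMatrix, Matrix.of_apply]
  split_ifs with h1 h2
  · exfalso
    obtain ⟨h1, h1'⟩ := h1
    obtain ⟨h2, h2'⟩ := h2
    rw [h1] at h2'
    rw [Option.map_eq_some_iff] at h1' h2'
    obtain ⟨p, hp, hpi⟩ := h1'
    obtain ⟨q, hq, hqi⟩ := h2'
    obtain ⟨ha, rfl⟩ := List.getElem?_eq_some_iff.1 hp
    obtain ⟨hb, rfl⟩ := List.getElem?_eq_some_iff.1 hq
    exact List.isChain_iff_getElem.1 hl a.val hb (hpi.trans hqi.symm)
  · simp
  · simp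
  · simp

theorem syllableMatrix_mem (i : ℕ) : syllableMatrix l i ∈ upperBand (l.length + 1) 1 := by
  intro a b h
  simp only [syllableMatrix, Matrix.of_apply]
  rw [if_neg]
  rintro ⟨h1, -⟩
  lia

theorem mul_one_add_smul_apply {n : ℕ} (M A : Matrix (Fin n) (Fin n) ℤ) (e : ℤ) (a b : Fin n) :
    (M * (1 + e • A)) a b = M a b + e * ∑ k, M a k * A k b := by
  rw [mul_add, mul_one, Matrix.add_apply, mul_smul_comm, Matrix.smul_apply, Matrix.mul_apply,
    smul_eq_mul]

/-- The product of the syllables, evaluated at the syllable matrices, has a nonzero corner. -/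
theorem syllable_prod_apply (hl : ∀ p ∈ l, p.2 ≠ 0) (m : ℕ) (hm : m ≤ l.length) :
    (∀ b : Fin (l.length + 1), m < b.val →
      ((l.take m).map fun p => 1 + p.2 • syllableMatrix l p.1).prod 0 b = 0) ∧
    ((l.take m).map fun p => 1 + p.2 • syllableMatrix l p.1).prod 0 ⟨m, by lia⟩ ≠ 0 := by
  -- Each factor moves at most one column to the right. Hence column `m + 1` of the first row is
  -- reached only from column `m`, and the entry there is multiplied by the nonzero exponent.
  induction m with
  | zero =>
    refine ⟨fun b hb => ?_, ?_⟩
    · simp only [List.take_zero, List.map_nil, List.prod_nil]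
      exact Matrix.one_apply_ne (by rintro rfl; exact lt_irrefl _ hb)
    · simp only [List.take_zero, List.map_nil, List.prod_nil]
      exact (Matrix.one_apply_eq (0 : Fin (l.length + 1))).trans_ne one_ne_zero
  | succ m ih =>
    obtain ⟨ih1, ih2⟩ := ih (by lia)
    have hm' : m < l.length := hm
    rw [List.take_succ_eq_append_getElem hm', List.map_append, List.prod_append]
    set M := ((l.take m).map fun p => 1 + p.2 • syllableMatrix l p.1).prod
    rw [List.map_singleton, List.prod_singleton]
    simp only [mul_one_add_smul_apply]
    refine ⟨fun b hb => ?_, ?_⟩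
    · rw [ih1 b (by lia), zero_add, Finset.sum_eq_zero, mul_zero]
      intro k _
      by_cases hk : m < k.val
      · rw [ih1 k hk, zero_mul]
      · simp only [syllableMatrix, Matrix.of_apply]
        rw [if_neg, mul_zero]
        rintro ⟨h1, -⟩
        lia
    · rw [ih1 _ (Nat.lt_succ_self m), zero_add,
        Finset.sum_eq_single (⟨m, by lia⟩ : Fin (l.length + 1))]
      · refine mul_ne_zero (hl _ (List.getElem_mem _)) (mul_ne_zero ih2 ?_)
        simp [syllableMatrix, hm']
      · intro k _ hk
        simp only [syllableMatrix, Matrix.of_apply]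
        rw [if_neg, mul_zero]
        rintro ⟨h1, -⟩
        exact hk (Fin.ext (Nat.succ_injective h1.symm))
      · simp

end syllableMatrix

/-- The `i`-th letter is sent to `1 + A`, with `A` the `i`-th syllable matrix. As `A² = 0`, powers
are linear in the exponent, so the value of the word has a nonzero corner off the diagonal. -/
theorem exists_isNilpotent_lift_ne_one (v : FreeGroup ℕ) (hv : v ≠ 1) :
    ∃ (H : Type) (_ : Group H), Group.IsNilpotent H ∧ ∃ f : ℕ → H, FreeGroup.lift f v ≠ 1 := by
  obtain ⟨l, hl, hl0, rfl⟩ := exists_syllables v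
  have hpos : 0 < l.length := List.length_pos_iff.2 (by rintro rfl; simp at hv)
  let U := unitFiltration (upperBand_antitone (l.length + 1)) mul_mem_upperBand 1
  let u : ℕ → (Matrix (Fin (l.length + 1)) (Fin (l.length + 1)) ℤ)ˣ := fun i =>
    unitOfSqZero (syllableMatrix l i) (syllableMatrix_mul_self hl i)
  have hu : ∀ i, u i ∈ U := by
    intro i
    refine ⟨?_, ?_⟩
    · change 1 + syllableMatrix l i - 1 ∈ _
      rw [add_sub_cancel_left]
      exact syllableMatrix_mem i
    · change 1 - syllableMatrix l i - 1 ∈ _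
      rw [sub_sub_cancel_left]
      exact neg_mem (syllableMatrix_mem i)
  refine ⟨U, inferInstance, isNilpotent_unitFiltration_one _ _ (one_mem_upperBand _)
    (upperBand_eq_bot _), fun i => ⟨u i, hu i⟩, fun h => ?_⟩
  have h1 : (Units.coeHom _).comp U.subtype (FreeGroup.lift (fun i => (⟨u i, hu i⟩ : U))
      (l.map fun p => FreeGroup.of p.1 ^ p.2).prod) = 1 := by rw [h, map_one]
  rw [map_list_prod, map_list_prod, List.map_map, List.map_map] at h1
  have h2 : (l.map fun p => 1 + p.2 • syllableMatrix l p.1).prod = 1 := by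
    refine Eq.trans ?_ h1
    congr 1
    refine List.map_congr_left fun p _ => ?_
    simp only [Function.comp_apply, map_zpow, FreeGroup.lift_apply_of, MonoidHom.comp_apply,
      Subgroup.coe_subtype, Units.coeHom_apply]
    exact (val_unitOfSqZero_zpow _ _ _).symm
  have h3 := (syllable_prod_apply hl0 l.length le_rfl).2
  rw [List.take_length, h2] at h3
  refine h3 (Matrix.one_apply_ne ?_)
  intro h4
  have := congrArg Fin.val h4
  simp at this
  lia

/-! ### Wreath products -/

namespace RegularWreathProduct

variable {A B : Type*} [Group A] [Group B]

/-- The inclusion of the base group. -/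
def baseHom : (B → A) →* A ≀ᵣ B where
  toFun f := ⟨f, 1⟩
  map_one' := rfl
  map_mul' f g := by ext <;> simp

@[simp]
theorem baseHom_left (f : B → A) : (baseHom f).left = f := rfl

@[simp]
theorem baseHom_right (f : B → A) : (baseHom f).right = 1 := rfl

theorem eq_baseHom_of_right_eq_one {w : A ≀ᵣ B} (hw : w.right = 1) : w = baseHom w.left := by
  ext
  · rfl
  · exact hw

theorem baseHom_range : (baseHom : (B → A) →* A ≀ᵣ B).range = (rightHom : A ≀ᵣ B →* B).ker := by
  ext w
  constructor
  · rintro ⟨f, rfl⟩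
    rfl
  · intro hw
    exact ⟨w.left, (eq_baseHom_of_right_eq_one hw).symm⟩

theorem inl_mul_baseHom_mul_inv (b : B) (f : B → A) :
    inl b * baseHom f * (inl b)⁻¹ = baseHom fun x => f (b⁻¹ * x) := by
  ext <;> simp

open Classical in
/-- The function with value `a` at `1` and value `1` elsewhere. -/
noncomputable def singleHom : A →* A ≀ᵣ B :=
  baseHom.comp (MonoidHom.mulSingle (fun _ : B => A) 1)

theorem singleHom_left_one (a : A) : (singleHom a : A ≀ᵣ B).left 1 = a := by
  simp [singleHom]

theorem singleHom_left_of_ne (a : A) {b : B} (hb : b ≠ 1) : (singleHom a : A ≀ᵣ B).left b = 1 := by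
  classical exact Pi.mulSingle_eq_of_ne (M := fun _ : B => A) hb a

theorem singleHom_right (a : A) : (singleHom a : A ≀ᵣ B).right = 1 := rfl

theorem baseHom_eq_singleHom {f : B → A} (hf : ∀ b, b ≠ 1 → f b = 1) :
    (baseHom f : A ≀ᵣ B) = singleHom (f 1) := by
  ext b
  · by_cases hb : b = 1
    · subst hb
      rw [singleHom_left_one, baseHom_left]
    · rw [singleHom_left_of_ne _ hb, baseHom_left, hf b hb]
  · rfl

theorem baseHom_mul_singleHom_mul_inv (f : B → A) (a : A) :
    baseHom f * singleHom a * (baseHom f)⁻¹ = (singleHom (f 1 * a * (f 1)⁻¹) : A ≀ᵣ B) := by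
  have h : baseHom f * singleHom a * (baseHom f)⁻¹ =
      (baseHom (f * (singleHom a : A ≀ᵣ B).left * f⁻¹) : A ≀ᵣ B) := by
    rw [map_mul, map_mul, map_inv, ← eq_baseHom_of_right_eq_one (singleHom_right a)]
  rw [h, baseHom_eq_singleHom]
  · simp [singleHom_left_one]
  · intro b hb
    simp [singleHom_left_of_ne a hb]

open Classical in
/-- The function with value `a` at the powers of `b` with non-negative exponents and value `1`
elsewhere. -/
noncomputable def stair (b : B) (a : A) : B → A :=
  fun x => if x ∈ Set.range (fun n : ℕ => b ^ n) then a else 1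

/-- The stair and its translate by `b` differ only at the bottom step. The hypothesis on `b` keeps
`b⁻¹` off the stair. -/
theorem commutator_baseHom_stair {b : B} (hb : ∀ n : ℕ, b ^ (n + 1) ≠ 1) (a : A) :
    ⁅(baseHom (stair b a) : A ≀ᵣ B), inl b⁆ = singleHom a := by
  have h : ⁅(baseHom (stair b a) : A ≀ᵣ B), inl b⁆ =
      baseHom (stair b a * (fun x => stair b a (b⁻¹ * x))⁻¹) := by
    rw [map_mul, map_inv, ← inl_mul_baseHom_mul_inv, commutatorElement_def]
    group
  have h1 : stair b a 1 = a := if_pos ⟨0, pow_zero b⟩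
  have h2 : stair b a b⁻¹ = 1 := by
    refine if_neg ?_
    rintro ⟨n, hn⟩
    refine hb n ?_
    simp only at hn
    rw [pow_succ, hn, inv_mul_cancel]
  rw [h, baseHom_eq_singleHom]
  · simp [h1, h2]
  · intro x hx
    have : x ∈ Set.range (fun n : ℕ => b ^ n) ↔ b⁻¹ * x ∈ Set.range (fun n : ℕ => b ^ n) := by
      constructor
      · rintro ⟨n, rfl⟩
        cases n with
        | zero => exact absurd (pow_zero b) hx
        | succ n => exact ⟨n, by simp only [pow_succ']; group⟩
      · rintro ⟨n, hn⟩
        refine ⟨n + 1, ?_⟩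
        simp only at hn ⊢
        rw [pow_succ', hn, mul_inv_cancel_left]
    have h3 : stair b a (b⁻¹ * x) = stair b a x := by
      classical exact if_congr this.symm rfl rfl
    simp [h3]

/-! ### The order on the elements with well-ordered support -/

section order

variable [LinearOrder B]

/-- The elements whose base component has well-ordered support and values in `H`. -/
def wellSupported (hB : IsFullOrder B) (H : Subgroup A) : Subgroup (A ≀ᵣ B) where
  carrier := {w | (∀ b, w.left b ∈ H) ∧ (Function.mulSupport w.left).IsPWO}
  one_mem' := ⟨fun _ => H.one_mem, by simp [Function.mulSupport_one]⟩
  mul_mem' := by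
    rintro v w ⟨hv, hv'⟩ ⟨hw, hw'⟩
    refine ⟨fun b => H.mul_mem (hv b) (hw _), ?_⟩
    have hmono : StrictMono fun x : B => v.right * x := fun x y hxy => (hB x y hxy _).2
    -- The support of the product lies in the union of one support with a translate of the other,
    -- and translations preserve the order.
    refine (hv'.union (hw'.image_of_monotone hmono.monotone)).mono fun x hx => ?_
    by_contra h
    rw [Set.mem_union, not_or, Function.notMem_mulSupport] at h
    refine hx ?_
    have h2 : w.left (v.right⁻¹ * x) = 1 := by
      by_contra h3
      exact h.2 ⟨_, h3, mul_inv_cancel_left _ _⟩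
    simp [h.1, h2]
  inv_mem' := by
    rintro w ⟨hw, hw'⟩
    refine ⟨fun b => H.inv_mem (hw _), ?_⟩
    have hmono : StrictMono fun x : B => w.right⁻¹ * x := fun x y hxy => (hB x y hxy _).2
    refine (hw'.image_of_monotone hmono.monotone).mono fun x hx => ?_
    refine ⟨w.right * x, fun h => hx ?_, inv_mul_cancel_left _ _⟩
    simp [h]

/-- The positive cone of the order that compares base components at the least element of the
support. -/
def lexCone (hB : IsFullOrder B) (H : Subgroup A) (P : Set A) : Set (A ≀ᵣ B) :=
  {w | w ∈ wellSupported hB H ∧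
    (1 < w.right ∨ (w.right = 1 ∧ ∃ b, w.left b ∈ P ∧ ∀ b' < b, w.left b' = 1))}

/-- Well-ordered supports have least points. Conjugation by `h` translates the least point by
`h.right` and conjugates the value there by an element of `H`. Ordering only the subgroup `H` of `A`
lets the construction be iterated. -/
theorem isPositiveCone_lexCone (hB : IsFullOrder B) {H : Subgroup A} {P : Set A}
    (hP : IsPositiveCone H P) : IsPositiveCone (wellSupported hB H) (lexCone hB H P) where
  subset _ hx := hx.1
  one_notMem := by
    rintro ⟨-, h | ⟨-, b, hb, -⟩⟩
    · exact lt_irrefl _ h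
    · exact hP.one_notMem hb
  mul_mem := by
    have hQ := isPositiveCone_of_isFullOrder hB
    rintro x ⟨hx, hx'⟩ y ⟨hy, hy'⟩
    refine ⟨Subgroup.mul_mem _ hx hy, ?_⟩
    rcases hx' with hx' | ⟨hx1, b, hb, hb'⟩ <;> rcases hy' with hy' | ⟨hy1, d, hd, hd'⟩
    · exact Or.inl (hQ.mul_mem _ hx' _ hy')
    · left; simpa [hy1] using hx'
    · left; simpa [hx1] using hy'
    · right
      refine ⟨by simp [hx1, hy1], min b d, ?_, fun e he => ?_⟩
      · rcases lt_trichotomy b d with h | h | h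
        · simpa [min_eq_left h.le, hx1, hd' b h] using hb
        · subst h
          simpa [hx1] using hP.mul_mem _ hb _ hd
        · simpa [min_eq_right h.le, hx1, hb' d h] using hd
      · rw [lt_min_iff] at he
        simp [hx1, hb' e he.1, hd' e he.2]
  conj_mem := by
    have hQ := isPositiveCone_of_isFullOrder hB
    rintro h hh x ⟨hx, hx'⟩
    refine ⟨Subgroup.mul_mem _ (Subgroup.mul_mem _ hh hx) (Subgroup.inv_mem _ hh), ?_⟩
    rcases hx' with hx' | ⟨hx1, b, hb, hb'⟩
    · exact Or.inl (hQ.conj_mem _ (Subgroup.mem_top _) _ hx')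
    · right
      have hleft : ∀ s, (h * x * h⁻¹).left s = h.left s * x.left (h.right⁻¹ * s) * (h.left s)⁻¹ := by
        intro s
        simp [hx1]
      refine ⟨by simp [hx1], h.right * b, ?_, fun e he => ?_⟩
      · rw [hleft, inv_mul_cancel_left]
        exact hP.conj_mem _ (hh.1 _) _ hb
      · have h1 := (hB _ _ he h.right⁻¹).2
        rw [inv_mul_cancel_left] at h1
        rw [hleft, hb' _ h1, mul_one, mul_inv_cancel]
  mem_or_inv_mem := by
    have hQ := isPositiveCone_of_isFullOrder hB
    intro w hw hw1
    by_cases hr : w.right = 1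
    · have hne : (Function.mulSupport w.left).Nonempty := by
        rw [Function.mulSupport_nonempty_iff]
        intro h
        exact hw1 (RegularWreathProduct.ext h hr)
      set b := hw.2.isWF.min hne with hbdef
      have hb : w.left b ≠ 1 := hw.2.isWF.min_mem hne
      have hb' : ∀ e < b, w.left e = 1 := by
        intro e he
        by_contra h
        exact hw.2.isWF.not_lt_min hne h he
      rcases hP.mem_or_inv_mem _ (hw.1 b) hb with h | h
      · exact Or.inl ⟨hw, Or.inr ⟨hr, b, h, hb'⟩⟩
      · refine Or.inr ⟨Subgroup.inv_mem _ hw, Or.inr ⟨by simp [hr], b, by simpa [hr] using h, ?_⟩⟩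
        intro e he
        simp [hr, hb' e he]
    · rcases hQ.mem_or_inv_mem _ (Subgroup.mem_top _) hr with h | h
      · exact Or.inl ⟨hw, Or.inl h⟩
      · exact Or.inr ⟨Subgroup.inv_mem _ hw, Or.inl h⟩

theorem isPWO_range_pow (hB : IsFullOrder B) {b : B} (hb : 1 < b) :
    (Set.range fun n : ℕ => b ^ n).IsPWO := by
  have hmono : Monotone fun n : ℕ => b ^ n := by
    refine monotone_nat_of_le_succ fun n => ?_
    have := (hB _ _ hb (b ^ n)).2
    rw [mul_one] at this
    exact this.le.trans (pow_succ b n).ge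
  rw [← Set.image_univ]
  exact (Set.isPWO_of_wellQuasiOrderedLE _).image_of_monotone hmono

theorem inl_mem_wellSupported (hB : IsFullOrder B) (H : Subgroup A) (b : B) :
    inl b ∈ wellSupported hB H := by
  refine ⟨fun _ => H.one_mem, ?_⟩
  rw [left_inl, Function.mulSupport_one]
  exact Set.isPWO_empty

theorem baseHom_stair_mem_wellSupported (hB : IsFullOrder B) {H : Subgroup A} {b : B} (hb : 1 < b)
    {a : A} (ha : a ∈ H) : baseHom (stair b a) ∈ wellSupported hB H := by
  refine ⟨fun x => ?_, (isPWO_range_pow hB hb).mono fun x hx => ?_⟩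
  · simp only [baseHom_left, stair]
    split_ifs
    exacts [ha, H.one_mem]
  · by_contra h
    exact hx (if_neg h)

theorem singleHom_mem_lexCone (hB : IsFullOrder B) {H : Subgroup A} {P : Set A}
    (hP : IsPositiveCone H P) {a : A} (ha : a ∈ P) : singleHom a ∈ lexCone hB H P := by
  refine ⟨⟨fun b => ?_, ?_⟩, Or.inr ⟨rfl, 1, ?_, fun b hb => singleHom_left_of_ne a hb.ne⟩⟩
  · by_cases hb : b = 1
    · rw [hb, singleHom_left_one]
      exact hP.subset a ha
    · rw [singleHom_left_of_ne a hb]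
      exact H.one_mem
  · refine (Set.isPWO_singleton (1 : B)).mono fun b hb => ?_
    by_contra h
    exact hb (singleHom_left_of_ne a h)
  · rw [singleHom_left_one]
    exact ha

theorem pow_succ_ne_one (hB : IsFullOrder B) {b : B} (hb : 1 < b) (n : ℕ) : b ^ (n + 1) ≠ 1 := by
  have hQ := isPositiveCone_of_isFullOrder hB
  have : ∀ n : ℕ, b ^ (n + 1) ∈ {x : B | 1 < x} := by
    intro n
    induction n with
    | zero => simpa using hb
    | succ n ih => rw [pow_succ]; exact hQ.mul_mem _ ih _ hb
  exact (this n).ne'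

end order

/-! ### Derived series and subnormal subgroups -/

/-- After `n` steps the derived series is inside the base group, where it is then bounded
coordinatewise. -/
theorem derivedSeries_eq_bot {n m : ℕ} (hB : derivedSeries B n = ⊥) (hA : derivedSeries A m = ⊥) :
    derivedSeries (A ≀ᵣ B) (n + m) = ⊥ := by
  have key : ∀ m, derivedSeries (A ≀ᵣ B) (n + m) ≤
      (Subgroup.pi Set.univ fun _ : B => derivedSeries A m).map baseHom := by
    intro m
    induction m with
    | zero =>
      intro w hw
      have h1 : rightHom w ∈ derivedSeries B n :=
        map_derivedSeries_le_derivedSeries _ _ (Subgroup.mem_map_of_mem _ hw)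
      rw [hB, Subgroup.mem_bot] at h1
      exact ⟨w.left, fun _ _ => Subgroup.mem_top _, (eq_baseHom_of_right_eq_one h1).symm⟩
    | succ m ih =>
      rw [← add_assoc, derivedSeries_succ, Subgroup.commutator_le]
      intro v hv w hw
      obtain ⟨f, hf, rfl⟩ := ih hv
      obtain ⟨g, hg, rfl⟩ := ih hw
      refine ⟨⁅f, g⁆, fun b _ => ?_, map_commutatorElement _ _ _⟩
      exact Subgroup.commutator_mem_commutator (hf b trivial) (hg b trivial)
  rw [eq_bot_iff]
  refine (key m).trans ?_
  rintro _ ⟨f, hf, rfl⟩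
  rw [hA] at hf
  have : f = 1 := funext fun b => hf b trivial
  rw [this, map_one]
  exact Subgroup.mem_bot.2 rfl

/-- The functions concentrated at `1` are normal in the base group, which is the kernel of the
projection to `B`. -/
theorem isSubnormal_map_singleHom {H : Subgroup A} (hH : H.IsSubnormal) :
    (H.map (singleHom : A →* A ≀ᵣ B)).IsSubnormal := by
  have h1 : (baseHom : (B → A) →* A ≀ᵣ B).range.IsSubnormal := by
    rw [baseHom_range]
    exact Subgroup.Normal.isSubnormal inferInstance
  have h2 : (singleHom : A →* A ≀ᵣ B).range.IsSubnormal := by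
    refine .step _ (baseHom : (B → A) →* A ≀ᵣ B).range ?_ h1 ⟨?_⟩
    · rintro _ ⟨a, rfl⟩
      exact ⟨_, rfl⟩
    · rintro ⟨_, -⟩ ⟨a, rfl⟩ ⟨_, ⟨f, rfl⟩⟩
      exact ⟨_, (baseHom_mul_singleHom_mul_inv f a).symm⟩
  have h3 := (hH.map (singleHom : A →* A ≀ᵣ B).rangeRestrict_surjective).trans' h2
  rwa [Subgroup.map_map] at h3

end RegularWreathProduct

/-! ### Verbal subgroups -/

section verbal

variable {V : Set (FreeGroup ℕ)} {G K : Type*} [Group G] [Group K]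

theorem map_mem_verbalSubgroup (f : G →* K) {g : G} (hg : g ∈ verbalSubgroup V G) :
    f g ∈ verbalSubgroup V K := by
  have h : (verbalSubgroup V G).map f ≤ verbalSubgroup V K := by
    rw [verbalSubgroup, MonoidHom.map_closure, Subgroup.closure_le]
    rintro _ ⟨_, ⟨v, hv, e, rfl⟩, rfl⟩
    refine Subgroup.subset_closure ⟨v, hv, fun i => f (e i), ?_⟩
    have : FreeGroup.lift (fun i => f (e i)) = f.comp (FreeGroup.lift e) := by
      ext i; simp
    rw [this]
    rfl
  exact h (Subgroup.mem_map_of_mem f hg)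

instance verbalSubgroup_normal : (verbalSubgroup V G).Normal :=
  ⟨fun _ hg h => map_mem_verbalSubgroup (MulAut.conj h).toMonoidHom hg⟩

theorem commutator_mem_verbalSubgroup {g h : G} (hh : h ∈ verbalSubgroup V G) :
    ⁅g, h⁆ ∈ verbalSubgroup V G :=
  Subgroup.mul_mem _ (verbalSubgroup_normal.conj_mem h hh g) (Subgroup.inv_mem _ hh)

end verbal

/-! ### Two-generator subgroups of wreath products with the infinite cyclic group -/

namespace RegularWreathProduct

theorem isFullOrder_of_isOrderedMonoid (B : Type*) [CommGroup B] [LinearOrder B]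
    [IsOrderedMonoid B] : IsFullOrder B :=
  fun _ _ h x => ⟨mul_lt_mul_left h x, mul_lt_mul_right h x⟩

/-- The standard generator of the infinite cyclic group. -/
abbrev zgen : Multiplicative ℤ := Multiplicative.ofAdd 1

theorem one_lt_zgen : 1 < zgen := by
  change (0 : ℤ) < 1
  exact zero_lt_one

theorem zgen_pow (n : ℕ) : zgen ^ n = Multiplicative.ofAdd (n : ℤ) := by
  rw [← ofAdd_nsmul, nsmul_one]

theorem zgen_pow_injective : Function.Injective fun n : ℕ => zgen ^ n := by
  intro m n h
  simp only [zgen_pow] at h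
  exact_mod_cast Multiplicative.ofAdd.injective h

variable {E : Type*} [Group E]

open Classical in
/-- The function with value `p` at `1` and `q i` at the `3 ^ i`-th power of the generator. -/
noncomputable def spread (p : E) (q : ℕ → E) (x : Multiplicative ℤ) : E :=
  if x = 1 then p else if h : ∃ i : ℕ, zgen ^ 3 ^ i = x then q h.choose else 1

theorem spread_one (p : E) (q : ℕ → E) : spread p q 1 = p := if_pos rfl

theorem spread_pow (p : E) (q : ℕ → E) (i : ℕ) : spread p q (zgen ^ 3 ^ i) = q i := by
  have h1 : zgen ^ 3 ^ i ≠ 1 := by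
    intro h
    have := zgen_pow_injective (h.trans (pow_zero zgen).symm)
    exact pow_ne_zero i three_ne_zero this
  have h2 : ∃ j : ℕ, zgen ^ 3 ^ j = zgen ^ 3 ^ i := ⟨i, rfl⟩
  have h3 : h2.choose = i := Nat.pow_right_injective (by norm_num)
    (zgen_pow_injective h2.choose_spec)
  rw [spread, if_neg h1, dif_pos h2, h3]

theorem eq_one_or_exists_of_spread_ne_one {p : E} {q : ℕ → E} {x : Multiplicative ℤ}
    (h : spread p q x ≠ 1) : x = 1 ∨ ∃ i : ℕ, zgen ^ 3 ^ i = x := by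
  by_contra! h1
  refine h ?_
  rw [spread, if_neg h1.1, dif_neg (by simpa using h1.2)]

theorem spread_mem {p : E} {q : ℕ → E} {H : Subgroup E} (hp : p ∈ H) (hq : ∀ i, q i ∈ H)
    (x : Multiplicative ℤ) : spread p q x ∈ H := by
  unfold spread
  split_ifs
  exacts [hp, hq _, H.one_mem]

theorem baseHom_spread_mem_wellSupported {p : E} {q : ℕ → E} {H : Subgroup E} (hp : p ∈ H)
    (hq : ∀ i, q i ∈ H) : baseHom (spread p q) ∈
      wellSupported (isFullOrder_of_isOrderedMonoid (Multiplicative ℤ)) H := by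
  refine ⟨spread_mem hp hq, (isPWO_range_pow
    (isFullOrder_of_isOrderedMonoid (Multiplicative ℤ)) one_lt_zgen).mono fun x hx => ?_⟩
  rcases eq_one_or_exists_of_spread_ne_one hx with rfl | ⟨i, rfl⟩
  · exact ⟨0, pow_zero _⟩
  · exact ⟨3 ^ i, rfl⟩

/-- The subgroup generated by a spread function and the generator of the top group. -/
def spreadSubgroup (p : E) (q : ℕ → E) : Subgroup (E ≀ᵣ Multiplicative ℤ) :=
  Subgroup.closure {baseHom (spread p q), inl zgen}

/-- A sum of two odd numbers is even. This is the sparseness that separates the support of a spread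
function from its translates. -/
theorem three_pow_add_three_pow_ne (i j k : ℕ) : 3 ^ i + 3 ^ j ≠ 3 ^ k := by
  intro h
  have h1 : ∀ n : ℕ, Odd (3 ^ n) := fun n => Odd.pow (by decide)
  have h2 := (h1 i).add_odd (h1 j)
  rw [h] at h2
  exact Nat.not_even_iff_odd.2 (h1 k) h2

/-- Translating the spread function brings `q i` over the entry `p`. The two supports meet nowhere
else, so the commutator with the original function is concentrated at `1`. -/
theorem singleHom_commutator_mem_spreadSubgroup (p : E) (q : ℕ → E) (i : ℕ) :
    singleHom ⁅q i, p⁆ ∈ spreadSubgroup p q := by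
  set ω := spread p q with hω
  set t : Multiplicative ℤ := zgen ^ 3 ^ i with ht
  have hb : baseHom ω ∈ spreadSubgroup p q := Subgroup.subset_closure (Or.inl rfl)
  have hgen : inl zgen ∈ spreadSubgroup p q := Subgroup.subset_closure (Or.inr rfl)
  have hz : inl t⁻¹ ∈ spreadSubgroup p q := by
    rw [map_inv, ht, map_pow]
    exact Subgroup.inv_mem _ (Subgroup.pow_mem _ hgen _)
  have h1 : baseHom ⁅(fun x => ω (t * x)), ω⁆ ∈ spreadSubgroup p q := by
    have h2 : baseHom (fun x => ω (t * x)) ∈ spreadSubgroup p q := by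
      have := Subgroup.mul_mem _ (Subgroup.mul_mem _ hz hb) (Subgroup.inv_mem _ hz)
      rw [inl_mul_baseHom_mul_inv, inv_inv] at this
      exact this
    rw [map_commutatorElement, commutatorElement_def]
    exact Subgroup.mul_mem _ (Subgroup.mul_mem _ (Subgroup.mul_mem _ h2 hb)
      (Subgroup.inv_mem _ h2)) (Subgroup.inv_mem _ hb)
  rw [baseHom_eq_singleHom] at h1
  · have h3 : ⁅fun x => ω (t * x), ω⁆ 1 = ⁅q i, p⁆ := by
      change ⁅ω (t * 1), ω 1⁆ = _
      rw [mul_one, ht, hω, spread_pow, spread_one]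
    rwa [h3] at h1
  · intro x hx
    change ⁅ω (t * x), ω x⁆ = 1
    by_cases hx1 : ω x = 1
    · rw [hx1, commutatorElement_one_right]
    · by_cases hx2 : ω (t * x) = 1
      · rw [hx2, commutatorElement_one_left]
      · exfalso
        rcases eq_one_or_exists_of_spread_ne_one hx1 with h | ⟨j, rfl⟩
        · exact hx h
        · rw [ht, ← pow_add] at hx2
          rcases eq_one_or_exists_of_spread_ne_one hx2 with h | ⟨k, hk⟩
          · have := zgen_pow_injective (h.trans (pow_zero zgen).symm)
            have h4 : 0 < 3 ^ i := by positivity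
            lia
          · exact three_pow_add_three_pow_ne i j k (zgen_pow_injective hk).symm

end RegularWreathProduct

open RegularWreathProduct

/-- The embedding as functions concentrated at the identity, iterated three times. -/
noncomputable def tripleSingle (A S : Type*) [Group A] [Group S] :
    A →* ((A ≀ᵣ S) ≀ᵣ Multiplicative ℤ) ≀ᵣ Multiplicative ℤ :=
  singleHom.comp (singleHom.comp singleHom)

theorem isSubnormal_range_tripleSingle (A S : Type*) [Group A] [Group S] :
    (tripleSingle A S).range.IsSubnormal := by
  have h := isSubnormal_map_singleHom (B := Multiplicative ℤ) (isSubnormal_map_singleHom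
    (B := Multiplicative ℤ) (isSubnormal_map_singleHom (A := A) (B := S) .top))
  rwa [Subgroup.map_map, Subgroup.map_map, ← MonoidHom.range_eq_map] at h

theorem exists_two_generator_subgroup (V : Set (FreeGroup ℕ)) (A S : Type*) [CommGroup A]
    [LinearOrder A] [IsOrderedMonoid A] [Countable A] [Group S] [LinearOrder S] [Countable S]
    (hS : IsFullOrder S) {a : S} (haV : a ∈ verbalSubgroup V S) (ha : 1 < a) :
    ∃ (G : Subgroup (((A ≀ᵣ S) ≀ᵣ Multiplicative ℤ) ≀ᵣ Multiplicative ℤ)) (_ : LinearOrder G),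
      IsFullOrder G ∧ (∃ x y : G, Subgroup.closure {x, y} = ⊤) ∧
      ∃ φ : A →* G, Function.Injective φ ∧ (∀ p q : A, p < q ↔ φ p < φ q) ∧
        φ.range.IsSubnormal ∧ φ.range ≤ verbalSubgroup V G := by
  obtain ⟨e, he⟩ := exists_surjective_nat (S ⊕ A)
  let gen : S ⊕ A → A ≀ᵣ S := Sum.elim inl fun x => baseHom (stair a x)
  have hZ := isFullOrder_of_isOrderedMonoid (Multiplicative ℤ)
  let H₁ : Subgroup (A ≀ᵣ S) := wellSupported hS ⊤
  let H₂ : Subgroup ((A ≀ᵣ S) ≀ᵣ Multiplicative ℤ) := wellSupported hZ H₁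
  let H₃ : Subgroup (((A ≀ᵣ S) ≀ᵣ Multiplicative ℤ) ≀ᵣ Multiplicative ℤ) := wellSupported hZ H₂
  have hP₀ := isPositiveCone_of_isFullOrder (isFullOrder_of_isOrderedMonoid A)
  have hP₁ := isPositiveCone_lexCone hS hP₀
  have hP₂ := isPositiveCone_lexCone hZ hP₁
  have hP₃ := isPositiveCone_lexCone hZ hP₂
  have hgen : ∀ s, gen s ∈ H₁ := by
    rintro (s | x)
    · exact inl_mem_wellSupported hS ⊤ s
    · exact baseHom_stair_mem_wellSupported hS ha (Subgroup.mem_top x)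
  let p : (A ≀ᵣ S) ≀ᵣ Multiplicative ℤ := inl zgen
  -- With this choice `⁅q i, p⁆` is the generator `gen (e i)` placed at the identity.
  let q : ℕ → (A ≀ᵣ S) ≀ᵣ Multiplicative ℤ := fun i => baseHom (stair zgen (gen (e i)))
  let G := spreadSubgroup p q
  have hp : p ∈ H₂ := inl_mem_wellSupported hZ H₁ _
  have hq : ∀ i, q i ∈ H₂ := fun i =>
    baseHom_stair_mem_wellSupported hZ one_lt_zgen (hgen (e i))
  -- Both generators of `G` have well-ordered supports at all three levels, so the iterated
  -- lexicographic cone orders `G`.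
  have hGH : G ≤ H₃ := by
    refine (Subgroup.closure_le _).2 ?_
    rintro _ (rfl | rfl)
    · exact baseHom_spread_mem_wellSupported hp hq
    · exact inl_mem_wellSupported hZ H₂ _
  let K : Subgroup (A ≀ᵣ S) := Subgroup.closure (Set.range gen)
  let ι : A ≀ᵣ S →* ((A ≀ᵣ S) ≀ᵣ Multiplicative ℤ) ≀ᵣ Multiplicative ℤ := singleHom.comp singleHom
  have hKG : ∀ k ∈ K, ι k ∈ G := by
    have h : K ≤ G.comap ι := by
      refine (Subgroup.closure_le _).2 ?_
      rintro _ ⟨s, rfl⟩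
      obtain ⟨i, rfl⟩ := he s
      have h1 := singleHom_commutator_mem_spreadSubgroup p q i
      rwa [commutator_baseHom_stair (pow_succ_ne_one hZ one_lt_zgen)] at h1
    exact fun k hk => h hk
  let j : K →* G := (ι.comp K.subtype).codRestrict G fun k => hKG k k.2
  let s : S →* K := inl.codRestrict K fun x => Subgroup.subset_closure ⟨Sum.inl x, rfl⟩
  have hcomm : ∀ x : A, ∃ k : K, (k : A ≀ᵣ S) = singleHom x ∧ k ∈ verbalSubgroup V K := by
    intro x
    refine ⟨⁅⟨gen (Sum.inr x), Subgroup.subset_closure ⟨Sum.inr x, rfl⟩⟩, s a⁆, ?_,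
      commutator_mem_verbalSubgroup (map_mem_verbalSubgroup s haV)⟩
    -- One entry of the commutator is the image of `a`, so normality puts the commutator in the
    -- verbal subgroup of `K`.
    exact commutator_baseHom_stair (pow_succ_ne_one hS ha) x
  have hφG : ∀ x, tripleSingle A S x ∈ G := by
    intro x
    obtain ⟨k, hk, -⟩ := hcomm x
    have := hKG k k.2
    rwa [hk] at this
  let φ : A →* G := (tripleSingle A S).codRestrict G hφG
  obtain ⟨o, ho, ho'⟩ := (hP₃.comap G.subtype Subtype.val_injective
    fun x => hGH x.2).exists_fullOrder
  have hmono : StrictMono φ := by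
    intro x y hxy
    rw [ho', ← map_inv, ← map_mul]
    refine singleHom_mem_lexCone hZ hP₂ (singleHom_mem_lexCone hZ hP₁
      (singleHom_mem_lexCone hS hP₀ ?_))
    change 1 < x⁻¹ * y
    rwa [lt_inv_mul_iff_mul_lt, mul_one]
  refine ⟨G, o, ho, ⟨⟨baseHom (spread p q), Subgroup.subset_closure (Or.inl rfl)⟩,
    ⟨inl zgen, Subgroup.subset_closure (Or.inr rfl)⟩, ?_⟩, φ, hmono.injective,
    fun x y => hmono.lt_iff_lt.symm, ?_, ?_⟩
  · refine Subgroup.map_injective G.subtype_injective ?_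
    rw [MonoidHom.map_closure, ← MonoidHom.range_eq_map, Subgroup.range_subtype, Set.image_pair]
    rfl
  · have h : φ.range = (tripleSingle A S).range.subgroupOf G := by
      ext g
      constructor
      · rintro ⟨x, rfl⟩
        exact ⟨x, rfl⟩
      · rintro ⟨x, hx⟩
        exact ⟨x, Subtype.ext hx⟩
    rw [h]
    exact (isSubnormal_range_tripleSingle A S).subgroupOf
  · rintro _ ⟨x, rfl⟩
    obtain ⟨k, hk, hkV⟩ := hcomm x
    have h : φ x = j k := by
      refine Subtype.ext ?_
      change ι (singleHom x) = ι k
      rw [hk]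
    rw [h]
    exact map_mem_verbalSubgroup j hkV

/-- `S` contributes at most `c`, and ℚ and the two infinite cyclic groups one each. -/
theorem derivedSeries_tripleWreath (k c : ℕ) : derivedSeries (TripleWreath k c) (c + 3) = ⊥ := by
  have hcomm : ∀ (B : Type) [CommGroup B], derivedSeries B 1 = ⊥ := by
    intro B _
    rw [derivedSeries_one, commutator_eq_bot_iff_center_eq_top, CommGroup.center_eq_top]
  have h1 : derivedSeries (FreeNilpotentGroup k c) c = ⊥ := by
    rw [eq_bot_iff, ← lowerCentralSeries_freeNilpotentGroup k c]
    exact Subgroup.derived_le_lower_central c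
  have h2 := RegularWreathProduct.derivedSeries_eq_bot h1 (hcomm (Multiplicative ℚ))
  have h3 := RegularWreathProduct.derivedSeries_eq_bot (hcomm (Multiplicative ℤ)) h2
  have h4 := RegularWreathProduct.derivedSeries_eq_bot (hcomm (Multiplicative ℤ)) h3
  have h5 : c + 3 = 1 + (1 + (c + 1)) := by lia
  rw [h5]
  exact h4

/-! ### The main theorem -/

theorem exists_not_nilpotentVarietyLE {V : Set (FreeGroup ℕ)} (hV : NontrivialWordSet V) :
    ∃ n, ¬ NilpotentVarietyLE n V := by
  obtain ⟨v, hvV, hv⟩ : ∃ v ∈ V, v ≠ 1 := by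
    by_contra! h
    refine hV ?_
    rw [verbalSubgroup, Subgroup.closure_eq_bot_iff]
    rintro _ ⟨v, hv, f, rfl⟩
    rw [h v hv]
    exact map_one _
  obtain ⟨H, _, hH, f, hf⟩ := exists_isNilpotent_lift_ne_one v hv
  exact ⟨Group.nilpotencyClass H, fun h => hf (h H hH le_rfl v hvV f)⟩

theorem FreeGroup.exists_lift_eq_of_eqOn {G : Type*} [Group G] (v : FreeGroup ℕ) (f : ℕ → G) :
    ∃ k : ℕ, ∀ g : ℕ → G, (∀ i < k, g i = f i) → FreeGroup.lift g v = FreeGroup.lift f v := by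
  induction v using FreeGroup.induction_on with
  | C1 => exact ⟨0, fun g _ => by simp⟩
  | of i => exact ⟨i + 1, fun g hg => by simpa using hg i (Nat.lt_succ_self i)⟩
  | inv_of i ih =>
    obtain ⟨k, hk⟩ := ih
    exact ⟨k, fun g hg => by rw [_root_.map_inv, _root_.map_inv, hk g hg]⟩
  | mul x y hx hy =>
    obtain ⟨k, hk⟩ := hx
    obtain ⟨l, hl⟩ := hy
    refine ⟨max k l, fun g hg => ?_⟩
    rw [_root_.map_mul, _root_.map_mul, hk g fun i hi => hg i (lt_max_of_lt_left hi),
      hl g fun i hi => hg i (lt_max_of_lt_right hi)]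

/-- A violating assignment of `v` in `H` factors through `F_k(𝔑_c)`, where `k` bounds the letters of
`v`; so `v` already has a nontrivial value there. -/
theorem exists_verbalSubgroup_freeNilpotentGroup_ne_one {V : Set (FreeGroup ℕ)} {c : ℕ}
    (hc : ¬ NilpotentVarietyLE c V) :
    ∃ k, ∃ a ∈ verbalSubgroup V (FreeNilpotentGroup k c), a ≠ 1 := by
  simp only [NilpotentVarietyLE, InVariety] at hc
  push Not at hc
  obtain ⟨H, _, hH, hHc, v, hv, f, hf⟩ := hc
  obtain ⟨k, hk⟩ := FreeGroup.exists_lift_eq_of_eqOn v f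
  let π : FreeNilpotentGroup k c →* H := QuotientGroup.lift _
    (FreeGroup.lift fun i : Fin k => f i) fun g hg => by
      have h1 := Subgroup.mem_map_of_mem (FreeGroup.lift fun i : Fin k => f i) hg
      rw [Subgroup.map_lowerCentralSeries] at h1
      have h2 : _ ∈ (⊤ : Subgroup H).lowerCentralSeries c :=
        Subgroup.lowerCentralSeries_mono c le_top h1
      rwa [Subgroup.lowerCentralSeries_eq_bot_iff_nilpotencyClass_le.2 hHc, Subgroup.mem_bot] at h2
  let e : ℕ → FreeNilpotentGroup k c := fun i =>
    -- The value `1` beyond `k` is harmless: those letters do not affect the value of `v`.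
    if h : i < k then QuotientGroup.mk' _ (FreeGroup.of ⟨i, h⟩) else 1
  refine ⟨k, FreeGroup.lift e v, Subgroup.subset_closure ⟨v, hv, e, rfl⟩, fun h => hf ?_⟩
  rw [← hk (fun i => π (e i)), ← map_one π, ← h]
  · have : FreeGroup.lift (fun i => π (e i)) = π.comp (FreeGroup.lift e) := by ext i; simp
    rw [this]
    rfl
  · intro i hi
    simp only [e, dif_pos hi]
    change FreeGroup.lift (fun i : Fin k => f i) (FreeGroup.of ⟨i, hi⟩) = f i
    simp

theorem theorem2 (V : Set (FreeGroup ℕ)) (hV : NontrivialWordSet V) :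
    ∃ c : ℕ, IsLeast {n : ℕ | ¬ NilpotentVarietyLE n V} c ∧
      ∃ k : ℕ,
        (∃ _ : LinearOrder (FreeNilpotentGroup k c), IsFullOrder (FreeNilpotentGroup k c) ∧
          ∃ a ∈ verbalSubgroup V (FreeNilpotentGroup k c), 1 < a) ∧
        ∃ (G : Subgroup (TripleWreath k c)) (_ : LinearOrder G),
          IsFullOrder G ∧
          (∃ x y : G, Subgroup.closure {x, y} = ⊤) ∧
          derivedSeries G (c + 3) = ⊥ ∧
          ∃ φ : Multiplicative ℚ →* G,
            Function.Injective φ ∧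
            (∀ p q : Multiplicative ℚ, p < q ↔ φ p < φ q) ∧
            φ.range.IsSubnormal ∧
            φ.range ≤ verbalSubgroup V G := by
  classical
  have hex := exists_not_nilpotentVarietyLE hV
  have hleast : IsLeast {n : ℕ | ¬ NilpotentVarietyLE n V} (Nat.find hex) :=
    ⟨Nat.find_spec hex, fun n hn => Nat.find_min' hex hn⟩
  obtain ⟨k, b, hbV, hb⟩ := exists_verbalSubgroup_freeNilpotentGroup_ne_one hleast.1
  refine ⟨Nat.find hex, hleast, k, ?_⟩
  generalize Nat.find hex = c at *
  obtain ⟨P, hP⟩ := exists_isPositiveCone_freeNilpotentGroup k c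
  obtain ⟨o, ho, ho'⟩ := hP.exists_fullOrder
  obtain ⟨a, haV, ha⟩ : ∃ a ∈ verbalSubgroup V (FreeNilpotentGroup k c), 1 < a := by
    rcases (isPositiveCone_of_isFullOrder ho).mem_or_inv_mem b (Subgroup.mem_top b) hb with h | h
    · exact ⟨b, hbV, h⟩
    · exact ⟨b⁻¹, Subgroup.inv_mem _ hbV, h⟩
  have hcount : Countable (FreeNilpotentGroup k c) := Quotient.countable
  have hcountQ : Countable (Multiplicative ℚ) := inferInstanceAs (Countable ℚ)
  refine ⟨⟨o, ho, a, haV, ha⟩, ?_⟩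
  obtain ⟨G, oG, hoG, hgen, hφ⟩ :=
    exists_two_generator_subgroup V (Multiplicative ℚ) (FreeNilpotentGroup k c) ho haV ha
  refine ⟨G, oG, hoG, hgen, ?_, hφ⟩
  have h := map_derivedSeries_le_derivedSeries G.subtype (c + 3)
  rw [derivedSeries_tripleWreath, le_bot_iff] at h
  exact (Subgroup.map_eq_bot_iff_of_injective _ G.subtype_injective).1 h
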